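/- Let $m,k\ge 1$, let $\Omega\subset\mathbb C^m$ be open, connected and bounded, and let $\mathcal A(\Omega)$ be the closure in $C(\overline\Omega)$, for the supremum norm, of the functions that are holomorphic on a neighbourhood of $\overline\Omega$. Let $\mathcal Z\subset\Omega$ be a connected hypersurface, i.e. a connected complex submanifold of dimension $m-1$. A function vanishes to order $k$ on $\mathcal Z$ if near each point of $\mathcal Z$ it is of the form $\varphi^k g$ with $g$ holomorphic and $\varphi$ a local defining function of $\mathcal Z$ (so $\mathcal Z=\{\varphi=0\}$ locally and $d\varphi\neq0$ on $\mathcal Z$). Let $\mathcal M$ and $\tilde{\mathcal M}$ be quasi-free Hilbert modules of rank one over $\mathcal A(\Omega)$. That is, each is a Hilbert space completion of $\mathcal A(\Omega)$ such that (1) evaluations at points of $\Omega$ are locally uniformly bounded, (2) multiplication by each $f\in\mathcal A(\Omega)$ is bounded, and (3) a norm-Cauchy sequence in $\mathcal A(\Omega)$ tends to $0$ in norm if and only if it tends to $0$ pointwise on $\Omega$. Elements of $\mathcal M$ are thereby functions on $\Omega$, and $\mathcal M$ has a reproducing kernel $K$. The hermitian holomorphic line bundle of $\mathcal M$ is the bundle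 over $\Omega^*=\{\bar w: w\in\Omega\}$ whose fibre at $\bar w$ is spanned by $K(\cdot,w)$, with the inner product of $\mathcal M$. Let $s$ be a holomorphic frame of it and put $\varrho(w)=\|s(\bar w)\|^2$ for $w\in\Omega$ (for the frame $s(\bar w)=K(\cdot,w)$ this is $K(w,w)$). Let $\tilde s$ and $\tilde\varrho$ be the corresponding objects for $\tilde{\mathcal M}$. Let $\mathcal M_0\subset\mathcal M$ be the submodule of functions vanishing to order $k$ on $\mathcal Z$, and let $\mathcal Q=\mathcal M\ominus\mathcal M_0$ be the quotient module, with action $f\cdot(h+\mathcal M_0)=f\cdot h+\mathcal M_0$. Define $\tilde{\mathcal M}_0$ and $\tilde{\mathcal Q}$ in the same way. (In particular $\mathcal Q,\tilde{\mathcal Q}$ may be any two quotient modules in the class $\mathrm B_k(\Omega,\mathcal Z)$.) Fix any family of holomorphic local coordinate systems $(z_1,\dots,z_m)$ on open subsets of $\Omega$ whose domains cover $\mathcal Z$ and in which $\mathcal Z=\{z_1=0\}$. Then $\mathcal Q$ and $\tilde{\mathcal Q}$ are unitarily isomorphic as Hilbert modules over $\mathcal A(\Omega)$ if and only if $\varrho$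 and $\tilde\varrho$ are equivalent to order $k$ on $\mathcal Z$, i.e. in each of these coordinate systems $$\mathcal D_k\Big(\log\frac{\tilde\varrho}{\varrho}\Big)=0\quad\text{on }\mathcal Z .$$ Here $\mathcal D_k$ is the $k\times k$ (block) array of the operators $\bar P_r P_c$, where $P_c$ runs through $\partial'=(\partial_m,\dots,\partial_2)$, $\partial_1,\partial_1^2,\dots,\partial_1^{k-1}$, and $\bar P_r$ runs through the conjugate operators $\bar\partial'$, $\bar\partial_1,\dots,\bar\partial_1^{k-1}$; $\partial_j=\partial/\partial z_j$ and $\bar\partial_j=\partial/\partial\bar z_j$. -/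

import Mathlib

open scoped InnerProductSpace

noncomputable section

namespace JetQuotient

/-! ### The function algebra `𝒜(Ω)` -/

/-- Continuous functions on the closure of `Ω` that extend to a holomorphic function on some
open neighbourhood of the closure. -/
def holNear {m : ℕ} (Ω : Set (Fin m → ℂ)) : Subalgebra ℂ C(closure Ω, ℂ) where
  carrier := {f | ∃ (U : Set (Fin m → ℂ)) (F : (Fin m → ℂ) → ℂ), IsOpen U ∧ closure Ω ⊆ U ∧
    DifferentiableOn ℂ F U ∧ ∀ x : closure Ω, f x = F x}
  mul_mem' := by
    rintro f g ⟨U, F, hU, hΩU, hF, hf⟩ ⟨V, G, hV, hΩV, hG, hg⟩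
    exact ⟨U ∩ V, fun z => F z * G z, hU.inter hV, Set.subset_inter hΩU hΩV,
      (hF.mono Set.inter_subset_left).mul (hG.mono Set.inter_subset_right),
      fun x => by simp [hf x, hg x]⟩
  add_mem' := by
    rintro f g ⟨U, F, hU, hΩU, hF, hf⟩ ⟨V, G, hV, hΩV, hG, hg⟩
    exact ⟨U ∩ V, fun z => F z + G z, hU.inter hV, Set.subset_inter hΩU hΩV,
      (hF.mono Set.inter_subset_left).add (hG.mono Set.inter_subset_right),
      fun x => by simp [hf x, hg x]⟩
  algebraMap_mem' := fun c =>
    ⟨Set.univ, fun _ => c, isOpen_univ, Set.subset_univ _, differentiableOn_const c,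
      fun _ => rfl⟩

instance {m : ℕ} (Ω : Set (Fin m → ℂ)) : LocallyCompactSpace (closure Ω) :=
  isClosed_closure.isClosedEmbedding_subtypeVal.locallyCompactSpace

/-- `𝒜(Ω)`: the completion, in the supremum norm over the closure of the bounded set `Ω`, of the
functions holomorphic near the closure, i.e. their closure in the Banach algebra of continuous
functions on the compact set `closure Ω`. -/
def funAlg {m : ℕ} (Ω : Set (Fin m → ℂ)) : Subalgebra ℂ C(closure Ω, ℂ) :=
  (holNear Ω).topologicalClosure

/-- The value at a point `w ∈ Ω` of a function in `𝒜(Ω)`, as a linear functional. -/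
def evalAlg {m : ℕ} {Ω : Set (Fin m → ℂ)} (w : Ω) : funAlg Ω →ₗ[ℂ] ℂ where
  toFun f := (f : C(closure Ω, ℂ)) ⟨w, subset_closure w.2⟩
  map_add' _ _ := rfl
  map_smul' _ _ := rfl

/-! ### Quasi-free Hilbert modules of rank one -/

/-- The Hilbert space `H` is (through `incl`) a quasi-free Hilbert module of rank one over
`𝒜(Ω)`: a Hilbert space completion of `𝒜(Ω)` such that evaluations are locally uniformly bounded
on `Ω`, multiplication by each function of `𝒜(Ω)` is bounded, and a norm-Cauchy sequence in `𝒜(Ω)`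
tends to `0` in norm if and only if it tends to `0` pointwise on `Ω`. -/
structure QuasiFreeModule {m : ℕ} (Ω : Set (Fin m → ℂ)) (H : Type*) [NormedAddCommGroup H]
    [InnerProductSpace ℂ H] [CompleteSpace H] where
  incl : funAlg Ω →ₗ[ℂ] H
  denseRange_incl : DenseRange incl
  eval_locally_bounded : ∀ w ∈ Ω, ∃ V ∈ nhds w, ∃ C : ℝ, ∀ v : Ω, (v : Fin m → ℂ) ∈ V →
    ∀ f : funAlg Ω, ‖evalAlg v f‖ ≤ C * ‖incl f‖
  mul_bounded : ∀ f : funAlg Ω, ∃ C : ℝ, ∀ g : funAlg Ω, ‖incl (f * g)‖ ≤ C * ‖incl g‖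
  cauchy_tendsto_zero_iff : ∀ u : ℕ → funAlg Ω, CauchySeq (fun j => incl (u j)) →
    (Filter.Tendsto (fun j => incl (u j)) Filter.atTop (nhds 0) ↔
      ∀ w : Ω, Filter.Tendsto (fun j => evalAlg w (u j)) Filter.atTop (nhds 0))

namespace QuasiFreeModule

variable {m : ℕ} {Ω : Set (Fin m → ℂ)} {H : Type*} [NormedAddCommGroup H]
    [InnerProductSpace ℂ H] [CompleteSpace H]

/-- Evaluation `e_w` at `w ∈ Ω`, extended by continuity from `𝒜(Ω)` to the module. -/
def eval (M : QuasiFreeModule Ω H) (w : Ω) : H →L[ℂ] ℂ :=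
  LinearMap.extendOfNorm (E := funAlg Ω) (Eₗ := H) (F := ℂ) (𝕜 := ℂ) (𝕜₂ := ℂ) (evalAlg w) M.incl

theorem eval_incl (M : QuasiFreeModule Ω H) (w : Ω) (f : funAlg Ω) :
    M.eval w (M.incl f) = evalAlg w f := by
  obtain ⟨V, hV, C, hC⟩ := M.eval_locally_bounded w w.2
  have hb : ∃ C : ℝ, ∀ f : funAlg Ω, ‖evalAlg w f‖ ≤ C * ‖M.incl f‖ :=
    ⟨C, hC w (mem_of_mem_nhds hV)⟩
  have h := LinearMap.extendOfNorm_eq (E := funAlg Ω) (Eₗ := H) (F := ℂ) (𝕜 := ℂ) (𝕜₂ := ℂ)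
    (f := evalAlg w) (e := M.incl)
  have h' := h M.denseRange_incl hb f
  exact h'

/-- The function on `Ω` (extended by `0` to the whole space) given by an element of the module. -/
def toFun (M : QuasiFreeModule Ω H) (h : H) : (Fin m → ℂ) → ℂ :=
  open Classical in fun w => if hw : w ∈ Ω then M.eval ⟨w, hw⟩ h else 0

/-- The module action of `f ∈ 𝒜(Ω)`: multiplication by `f`, extended by continuity from `𝒜(Ω)`. -/
def act (M : QuasiFreeModule Ω H) (f : funAlg Ω) : H →L[ℂ] H :=
  LinearMap.extendOfNorm (E := funAlg Ω) (Eₗ := H) (F := H) (𝕜 := ℂ) (𝕜₂ := ℂ)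
    (M.incl ∘ₗ LinearMap.mulLeft ℂ f) M.incl

theorem act_incl (M : QuasiFreeModule Ω H) (f g : funAlg Ω) :
    M.act f (M.incl g) = M.incl (f * g) := by
  have h := LinearMap.extendOfNorm_eq (E := funAlg Ω) (Eₗ := H) (F := H) (𝕜 := ℂ) (𝕜₂ := ℂ)
    (f := M.incl ∘ₗ LinearMap.mulLeft ℂ f) (e := M.incl)
  have h' := h M.denseRange_incl (M.mul_bounded f) g
  exact h'

/-- The reproducing kernel vector `K(·, w)`, determined by `⟪K(·, w), h⟫ = h(w)`. -/
def kernelVec (M : QuasiFreeModule Ω H) (w : Ω) : H :=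
  (InnerProductSpace.toDual ℂ H).symm (M.eval w)

/-- A holomorphic frame of the hermitian holomorphic line bundle of the module. The bundle lives
over `Ω* = {v | star v ∈ Ω}`, its fibre at `star w` is the line spanned by `K(·, w)` with the inner
product of `H`, and a frame is a holomorphic nowhere vanishing section. -/
structure IsFrame (M : QuasiFreeModule Ω H) (s : (Fin m → ℂ) → H) : Prop where
  differentiableOn : DifferentiableOn ℂ s {v | star v ∈ Ω}
  mem_fibre : ∀ w : Ω, s (star (w : Fin m → ℂ)) ∈ Submodule.span ℂ {M.kernelVec w}
  ne_zero : ∀ w : Ω, s (star (w : Fin m → ℂ)) ≠ 0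

end QuasiFreeModule

/-- The hermitian metric of a line bundle over `Ω*` with respect to a frame `s`, as a function on
`Ω`. For the frame `star w ↦ K(·, w)` this is `w ↦ K(w, w)`. -/
def metric {m : ℕ} {H : Type*} [NormedAddCommGroup H] (s : (Fin m → ℂ) → H) :
    (Fin m → ℂ) → ℝ :=
  fun w => ‖s (star w)‖ ^ 2

/-! ### Hypersurfaces and order of vanishing -/

/-- `φ` is a local defining function of `Z` on the open set `U`. -/
structure IsLocalDefiningFunction {m : ℕ} (Z U : Set (Fin m → ℂ)) (φ : (Fin m → ℂ) → ℂ) :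
    Prop where
  isOpen : IsOpen U
  differentiableOn : DifferentiableOn ℂ φ U
  mem_iff : ∀ z ∈ U, z ∈ Z ↔ φ z = 0
  fderiv_ne_zero : ∀ z ∈ U ∩ Z, fderiv ℂ φ z ≠ 0

/-- `Z ⊆ Ω` is a complex submanifold of codimension one. -/
def IsHypersurface {m : ℕ} (Ω Z : Set (Fin m → ℂ)) : Prop :=
  Z ⊆ Ω ∧ ∀ p ∈ Z, ∃ U ⊆ Ω, p ∈ U ∧ ∃ φ, IsLocalDefiningFunction Z U φ

/-- `f` vanishes to order `k` on `Z`: near each point of `Z` it is a holomorphic multiple of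
`φ ^ k`, for the local defining functions `φ` of `Z`. -/
def VanishesToOrder {m : ℕ} (Z : Set (Fin m → ℂ)) (k : ℕ) (f : (Fin m → ℂ) → ℂ) : Prop :=
  ∀ p ∈ Z, ∀ U φ, p ∈ U → IsLocalDefiningFunction Z U φ →
    ∃ V ⊆ U, p ∈ V ∧ IsOpen V ∧ ∃ g, DifferentiableOn ℂ g V ∧ ∀ z ∈ V, f z = φ z ^ k * g z

/-! ### The quotient module -/

namespace QuasiFreeModule

variable {m : ℕ} {Ω : Set (Fin m → ℂ)} {H : Type*} [NormedAddCommGroup H]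
    [InnerProductSpace ℂ H] [CompleteSpace H]

theorem toFun_add (M : QuasiFreeModule Ω H) (h₁ h₂ : H) (z : Fin m → ℂ) :
    M.toFun (h₁ + h₂) z = M.toFun h₁ z + M.toFun h₂ z := by
  by_cases hz : z ∈ Ω <;> simp [toFun, hz]

theorem toFun_smul (M : QuasiFreeModule Ω H) (c : ℂ) (h : H) (z : Fin m → ℂ) :
    M.toFun (c • h) z = c * M.toFun h z := by
  by_cases hz : z ∈ Ω <;> simp [toFun, hz]

/-- `ℳ₀`: the elements of the module that vanish to order `k` on `Z`. -/
def vanishing (M : QuasiFreeModule Ω H) (Z : Set (Fin m → ℂ)) (k : ℕ) : Submodule ℂ H where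
  carrier := {h | VanishesToOrder Z k (M.toFun h)}
  zero_mem' := by
    intro p _ U φ hpU hφ
    refine ⟨U, subset_rfl, hpU, hφ.isOpen, fun _ => 0, differentiableOn_const 0, fun z _ => ?_⟩
    by_cases hz : z ∈ Ω <;> simp [toFun, hz]
  add_mem' := by
    intro h₁ h₂ H₁ H₂ p hp U φ hpU hφ
    obtain ⟨V₁, hV₁U, hp₁, ho₁, g₁, hg₁, e₁⟩ := H₁ p hp U φ hpU hφ
    obtain ⟨V₂, hV₂U, hp₂, ho₂, g₂, hg₂, e₂⟩ := H₂ p hp U φ hpU hφ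
    refine ⟨V₁ ∩ V₂, fun z hz => hV₁U hz.1, ⟨hp₁, hp₂⟩, ho₁.inter ho₂, fun z => g₁ z + g₂ z,
      (hg₁.mono Set.inter_subset_left).add (hg₂.mono Set.inter_subset_right), fun z hz => ?_⟩
    rw [toFun_add, e₁ z hz.1, e₂ z hz.2]
    ring
  smul_mem' := by
    intro c h H₁ p hp U φ hpU hφ
    obtain ⟨V, hVU, hpV, ho, g, hg, e⟩ := H₁ p hp U φ hpU hφ
    refine ⟨V, hVU, hpV, ho, fun z => c * g z, hg.const_mul c, fun z hz => ?_⟩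
    rw [toFun_smul, e z hz]
    ring

/-- `𝒬 = ℳ ⊖ ℳ₀`, the Hilbert space underlying the quotient module. -/
abbrev quotient (M : QuasiFreeModule Ω H) (Z : Set (Fin m → ℂ)) (k : ℕ) : Submodule ℂ H :=
  (M.vanishing Z k)ᗮ

/-- The module action on `𝒬`: `f · (h + ℳ₀) = f · h + ℳ₀`, where a class is represented by its
unique element orthogonal to `ℳ₀`. -/
def quotientAct (M : QuasiFreeModule Ω H) (Z : Set (Fin m → ℂ)) (k : ℕ) (f : funAlg Ω)
    (h : M.quotient Z k) : M.quotient Z k :=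
  (M.quotient Z k).orthogonalProjectionOnto (M.act f h)

end QuasiFreeModule

/-- The quotient modules of `M` and `M'` are (unitarily) isomorphic Hilbert modules over
`𝒜(Ω)`. -/
def QuotientsIsomorphic {m : ℕ} {Ω : Set (Fin m → ℂ)} {H H' : Type*}
    [NormedAddCommGroup H] [InnerProductSpace ℂ H] [CompleteSpace H]
    [NormedAddCommGroup H'] [InnerProductSpace ℂ H'] [CompleteSpace H']
    (M : QuasiFreeModule Ω H) (M' : QuasiFreeModule Ω H') (Z : Set (Fin m → ℂ)) (k : ℕ) : Prop :=
  ∃ V : M.quotient Z k ≃ₗᵢ[ℂ] M'.quotient Z k, ∀ (f : funAlg Ω) (h : M.quotient Z k),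
    V (M.quotientAct Z k f h) = M'.quotientAct Z k f (V h)

/-! ### The operators `𝒟_k` and equivalence to order `k` -/

/-- `∂/∂z_j` -/
def del {m : ℕ} (j : Fin m) (F : (Fin m → ℂ) → ℂ) : (Fin m → ℂ) → ℂ := fun z =>
  (fderiv ℝ F z (Pi.single j 1) - Complex.I * fderiv ℝ F z (Pi.single j Complex.I)) / 2

/-- `∂/∂z̄_j` -/
def delBar {m : ℕ} (j : Fin m) (F : (Fin m → ℂ) → ℂ) : (Fin m → ℂ) → ℂ := fun z =>
  (fderiv ℝ F z (Pi.single j 1) + Complex.I * fderiv ℝ F z (Pi.single j Complex.I)) / 2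

/-- The operators heading the columns of `𝒟_k`: the tangential `∂_j` (`j` not the first
coordinate), then `∂_1, ∂_1², …, ∂_1^(k-1)`. -/
def colOp {n k : ℕ} : Fin n ⊕ Fin (k - 1) → ((Fin (n + 1) → ℂ) → ℂ) → (Fin (n + 1) → ℂ) → ℂ
  | Sum.inl j => del j.succ
  | Sum.inr b => (del 0)^[(b : ℕ) + 1]

/-- The operators heading the rows of `𝒟_k`, conjugate to those heading the columns. -/
def rowOp {n k : ℕ} : Fin n ⊕ Fin (k - 1) → ((Fin (n + 1) → ℂ) → ℂ) → (Fin (n + 1) → ℂ) → ℂ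
  | Sum.inl i => delBar i.succ
  | Sum.inr a => (delBar 0)^[(a : ℕ) + 1]

/-- The array `𝒟_k F` at the point `z`; the `(1,1)` block is indexed by `Fin n × Fin n`. -/
def diffArray {n : ℕ} (k : ℕ) (F : (Fin (n + 1) → ℂ) → ℂ) (z : Fin (n + 1) → ℂ) :
    Matrix (Fin n ⊕ Fin (k - 1)) (Fin n ⊕ Fin (k - 1)) ℂ :=
  Matrix.of fun r c => rowOp r (colOp c F) z

/-- Holomorphic local coordinates on an open subset of `Ω` in which `Z` is the zero set of the
first coordinate. -/
structure IsAdaptedChart {n : ℕ} (Ω Z : Set (Fin (n + 1) → ℂ))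
    (e : OpenPartialHomeomorph (Fin (n + 1) → ℂ) (Fin (n + 1) → ℂ)) : Prop where
  source_subset : e.source ⊆ Ω
  differentiableOn : DifferentiableOn ℂ e e.source
  differentiableOn_symm : DifferentiableOn ℂ e.symm e.target
  mem_iff : ∀ z ∈ e.source, z ∈ Z ↔ e z 0 = 0

/-- `ρ` and `ρ'` are equivalent to order `k` on `Z`: in the given coordinate systems,
`𝒟_k (log (ρ' / ρ)) = 0` at all points of `Z`. -/
def EquivalentToOrder {n : ℕ} (Z : Set (Fin (n + 1) → ℂ))
    (charts : Set (OpenPartialHomeomorph (Fin (n + 1) → ℂ) (Fin (n + 1) → ℂ))) (k : ℕ)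
    (ρ ρ' : (Fin (n + 1) → ℂ) → ℝ) : Prop :=
  ∀ e ∈ charts, ∀ z ∈ e.source ∩ Z,
    diffArray k (fun x => ((Real.log (ρ' (e.symm x) / ρ (e.symm x)) : ℝ) : ℂ)) (e z) = 0

end JetQuotient

end

/-
Let `S`, `S'` be the frames of the two bundles in an adapted chart. The derivatives of `S` of order
`< k` in the normal direction, at points of `𝒵`, span a dense subspace of `𝒬`, and the adjoints of
the module action are triangular on them. Hence `𝒬` and `𝒬'` are isomorphic if and only if, for some
holomorphic `χ`, the jets of `S` and of `χ S'` have the same Gram matrices along `𝒵`; by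
connectedness of `𝒵` it suffices to have this near one point. In terms of the polarized metrics
`κ(x, y) = ⟪S(x̄), S(y)⟫`, which are holomorphic in both variables, the condition says that
`κ - κ_{χ S'}` lies in the ideal `(x₁ ^ k, y₁ ^ k)` along `x₁ = y₁ = 0`. Taking logarithms turns it
into the vanishing of `𝒟_k log (ϱ' / ϱ)`, since `log |χ|²` is killed by `𝒟_k`. Conversely,
`𝒟_k log (ϱ' / ϱ) = 0` polarizes from the antidiagonal `y = x̄` to all pairs of points of the slice,
and the derivatives not seen by `𝒟_k` are removed by choosing `χ` so that the potential is replaced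
by its diastasis, which vanishes for `x = q` and for `y = q̄`.
-/

noncomputable section

namespace JetQuotient

open Set Metric Filter Topology MeasureTheory

section Holomorphic

variable {E X : Type*} [NormedAddCommGroup E] [NormedSpace ℂ E]
  [NormedAddCommGroup X] [NormedSpace ℂ X]

theorem norm_fderiv_le_of_norm_le_on_ball {f : E → X} {x : E} {r C : ℝ} (hr : 0 < r)
    (hf : DifferentiableOn ℂ f (ball x r)) (hC : ∀ y ∈ ball x r, ‖f y‖ ≤ C) :
    ‖fderiv ℂ f x‖ ≤ 2 * C / r := by
  refine Complex.norm_fderiv_le_div_of_mapsTo_ball hf (fun y hy => ?_) hr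
  rw [mem_closedBall, dist_eq_norm]
  calc ‖f y - f x‖ ≤ ‖f y‖ + ‖f x‖ := norm_sub_le _ _
    _ ≤ 2 * C := by linarith [hC y hy, hC x (mem_ball_self hr)]

theorem continuousOn_fderiv_of_continuousOn_uncurry [FiniteDimensional ℂ E] {T : Type*}
    [TopologicalSpace T] {K : Set T} {U : Set E} (hU : IsOpen U) {F : T → E → X}
    (hF : ∀ t ∈ K, DifferentiableOn ℂ (F t) U)
    (hcont : ContinuousOn (Function.uncurry F) (K ×ˢ U)) {x : E} (hx : x ∈ U) :
    ContinuousOn (fun t => fderiv ℂ (F t) x) K := by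
  have : ProperSpace E := FiniteDimensional.proper ℂ E
  obtain ⟨δ, hδ, hball⟩ := nhds_basis_closedBall.mem_iff.1 (hU.mem_nhds hx)
  intro t ht
  refine Metric.tendsto_nhds.2 fun ε hε => ?_
  obtain ⟨V, hV, hclose⟩ := (isCompact_closedBall x δ).mem_uniformity_of_prod
    (hcont.mono (prod_mono subset_rfl hball)) ht
    (dist_mem_uniformity (show 0 < ε * δ / 4 by positivity))
  filter_upwards [hV, self_mem_nhdsWithin] with u huV hu
  have hdiff : ∀ w ∈ K, DifferentiableAt ℂ (F w) x := fun w hw =>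
    (hF w hw).differentiableAt (hU.mem_nhds hx)
  have hle : ∀ y ∈ ball x δ, ‖(F u - F t) y‖ ≤ ε * δ / 4 := fun y hy => by
    have hdist : dist (F u y) (F t y) < ε * δ / 4 := hclose u huV y (ball_subset_closedBall hy)
    exact (dist_eq_norm (F u y) (F t y) ▸ hdist).le
  rw [dist_eq_norm, ← fderiv_sub (hdiff u hu) (hdiff t ht)]
  calc ‖fderiv ℂ (F u - F t) x‖ ≤ 2 * (ε * δ / 4) / δ :=
        norm_fderiv_le_of_norm_le_on_ball hδ
          (((hF u hu).sub (hF t ht)).mono (ball_subset_closedBall.trans hball)) hle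
    _ < ε := by field_simp; linarith

theorem differentiableOn_intervalIntegral [FiniteDimensional ℂ E] {U : Set E} (hU : IsOpen U)
    {F : ℝ → E → X} {a b : ℝ} (hab : a ≤ b) (hF : ∀ t ∈ Icc a b, DifferentiableOn ℂ (F t) U)
    (hcont : ContinuousOn (Function.uncurry F) (Icc a b ×ˢ U)) :
    DifferentiableOn ℂ (fun x => ∫ t in a..b, F t x) U := by
  intro x₀ hx₀
  have : ProperSpace E := FiniteDimensional.proper ℂ E
  obtain ⟨r, hr, hball⟩ := nhds_basis_closedBall.mem_iff.1 (hU.mem_nhds hx₀)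
  obtain ⟨C, hC⟩ := (isCompact_Icc.prod (isCompact_closedBall x₀ r)).exists_bound_of_continuousOn
    (hcont.mono (prod_mono subset_rfl hball))
  have hsub : ∀ x ∈ ball x₀ (r / 2), ball x (r / 2) ⊆ closedBall x₀ r := fun x hx =>
    (ball_subset_ball' (by linarith [mem_ball.1 hx])).trans ball_subset_closedBall
  have hU' : ∀ x ∈ ball x₀ (r / 2), x ∈ U := fun x hx =>
    hball (hsub x hx (mem_ball_self (half_pos hr)))
  have hIcc : ∀ t ∈ uIoc a b, t ∈ Icc a b := fun t ht =>
    Ioc_subset_Icc_self (uIoc_of_le hab ▸ ht)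
  have hInt : ∀ x ∈ U, IntervalIntegrable (fun t => F t x) volume a b := fun x hx => by
    refine ContinuousOn.intervalIntegrable ?_
    rw [uIcc_of_le hab]
    exact hcont.comp (f := fun t => (t, x)) (by fun_prop) fun t ht => ⟨ht, hx⟩
  have hmeas : AEStronglyMeasurable (fun t => fderiv ℂ (F t) x₀)
      (volume.restrict (uIoc a b)) := by
    rw [uIoc_of_le hab]
    exact ((continuousOn_fderiv_of_continuousOn_uncurry hU hF hcont hx₀).mono
      Ioc_subset_Icc_self).aestronglyMeasurable measurableSet_Ioc
  refine (intervalIntegral.hasFDerivAt_integral_of_dominated_of_fderiv_le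
    (F := fun x t => F t x) (F' := fun x t => fderiv ℂ (F t) x)
    (bound := fun _ => 2 * C / (r / 2)) (ball_mem_nhds x₀ (half_pos hr)) ?_ (hInt x₀ hx₀) hmeas
    ?_ intervalIntegrable_const ?_).differentiableAt.differentiableWithinAt
  · filter_upwards [hU.mem_nhds hx₀] with x hx
    exact (intervalIntegrable_iff.1 (hInt x hx)).aestronglyMeasurable
  · exact Eventually.of_forall fun t ht x hx => norm_fderiv_le_of_norm_le_on_ball (half_pos hr)
      ((hF t (hIcc t ht)).mono ((hsub x hx).trans hball))
      fun y hy => hC (t, y) ⟨hIcc t ht, hsub x hx hy⟩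
  · exact Eventually.of_forall fun t ht x hx =>
      ((hF t (hIcc t ht)).differentiableAt (hU.mem_nhds (hU' x hx))).hasFDerivAt

theorem differentiableOn_circleIntegral [FiniteDimensional ℂ E] {U : Set E} (hU : IsOpen U)
    {F : ℂ → E → X} {c : ℂ} {ρ : ℝ} (hρ : 0 ≤ ρ)
    (hF : ∀ w ∈ sphere c ρ, DifferentiableOn ℂ (F w) U)
    (hcont : ContinuousOn (Function.uncurry F) (sphere c ρ ×ˢ U)) :
    DifferentiableOn ℂ (fun x => ∮ w in C(c, ρ), F w x) U := by
  have hcircle : ∀ θ, circleMap c ρ θ ∈ sphere c ρ := circleMap_mem_sphere c hρ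
  refine differentiableOn_intervalIntegral hU Real.two_pi_pos.le
    (fun θ _ => (hF _ (hcircle θ)).const_smul _) ?_
  have hderiv : Continuous fun p : ℝ × E => deriv (circleMap c ρ) p.1 := by
    simp only [deriv_circleMap]
    fun_prop
  exact hderiv.continuousOn.smul (hcont.comp (f := fun p : ℝ × E => (circleMap c ρ p.1, p.2))
    (by fun_prop) fun p hp => ⟨hcircle p.1, hp.2⟩)

/-- The derivative of `f` in the direction `v`, as an operator on functions that can be iterated
and composed. -/
def dirDeriv (v : E) (f : E → X) : E → X := fun z => fderiv ℂ f z v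

theorem deriv_comp_line {f : E → X} {z v : E} {t : ℂ} (hf : DifferentiableAt ℂ f (z + t • v)) :
    deriv (fun t : ℂ => f (z + t • v)) t = dirDeriv v f (z + t • v) := by
  have h : HasDerivAt (fun t : ℂ => z + t • v) v t := by
    simpa using ((hasDerivAt_id t).smul_const v).const_add z
  exact (hf.hasFDerivAt.comp_hasDerivAt t h).deriv

variable [CompleteSpace X]

theorem dirDeriv_eq_circleIntegral {U : Set E} (hU : IsOpen U) {f : E → X}
    (hf : DifferentiableOn ℂ f U) {x v : E} {ρ : ℝ} (hρ : 0 < ρ)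
    (hdisc : ∀ t : ℂ, ‖t‖ ≤ ρ → x + t • v ∈ U) :
    dirDeriv v f x =
      (2 * Real.pi * Complex.I : ℂ)⁻¹ • ∮ w in C(0, ρ), (w ^ 2)⁻¹ • f (x + w • v) := by
  have hline : Differentiable ℂ fun t : ℂ => x + t • v := by fun_prop
  have hsub : closedBall (0 : ℂ) ρ ⊆ (fun t : ℂ => x + t • v) ⁻¹' U := fun t ht =>
    hdisc t (mem_closedBall_zero_iff.1 ht)
  have hcauchy := Complex.cderiv_eq_deriv (hU.preimage hline.continuous)
    (hf.comp hline.differentiableOn fun t ht => ht) hρ hsub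
  have hx : DifferentiableAt ℂ f (x + (0 : ℂ) • v) :=
    hf.differentiableAt (hU.mem_nhds (hdisc 0 (by simpa using hρ.le)))
  simpa [Complex.cderiv, Function.comp_def, deriv_comp_line hx] using hcauchy.symm

theorem differentiableOn_dirDeriv [FiniteDimensional ℂ E] {U : Set E} (hU : IsOpen U)
    {f : E → X} (hf : DifferentiableOn ℂ f U) (v : E) : DifferentiableOn ℂ (dirDeriv v f) U := by
  intro x₀ hx₀
  have hnear : ∀ᶠ p : E × ℂ in 𝓝 x₀ ×ˢ 𝓝 0, p.1 + p.2 • v ∈ U := by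
    have hc : Continuous fun p : E × ℂ => p.1 + p.2 • v := by fun_prop
    rw [← nhds_prod_eq]
    exact hc.continuousAt.eventually_mem (hU.mem_nhds (by simpa using hx₀))
  obtain ⟨⟨W, ρ⟩, ⟨⟨hx₀W, hW⟩, hρ⟩, hWρ⟩ :=
    ((nhds_basis_opens x₀).prod nhds_basis_closedBall).eventually_iff.1 hnear
  have hdisc : ∀ x ∈ W, ∀ t : ℂ, ‖t‖ ≤ ρ → x + t • v ∈ U := fun x hx t ht =>
    hWρ (x := (x, t)) ⟨hx, by simpa using ht⟩
  have hmem : ∀ p ∈ sphere (0 : ℂ) ρ ×ˢ W, p.2 + p.1 • v ∈ U := fun p hp =>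
    hdisc p.2 hp.2 p.1 (mem_sphere_zero_iff_norm.1 hp.1).le
  have hsquare : ∀ p ∈ sphere (0 : ℂ) ρ ×ˢ W, p.1 ^ 2 ≠ 0 := fun p hp =>
    pow_ne_zero 2 (ne_zero_of_mem_sphere hρ.ne' ⟨p.1, hp.1⟩)
  have hInt : DifferentiableOn ℂ
      (fun x => ∮ w in C(0, ρ), (w ^ 2)⁻¹ • f (x + w • v)) W := by
    refine differentiableOn_circleIntegral hW hρ.le (fun w hw => ?_) ?_
    · exact (hf.comp (by fun_prop) fun x hx => hmem (w, x) ⟨hw, hx⟩).const_smul _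
    · exact (ContinuousOn.inv₀ (by fun_prop) hsquare).smul
        (hf.continuousOn.comp (Continuous.continuousOn (by fun_prop)) hmem)
  have hW' : DifferentiableOn ℂ (dirDeriv v f) W := (hInt.const_smul _).congr fun x hx =>
    dirDeriv_eq_circleIntegral hU hf hρ (hdisc x hx)
  exact (hW'.differentiableAt (hW.mem_nhds hx₀W)).differentiableWithinAt

theorem contDiffOn_of_differentiableOn [FiniteDimensional ℂ E] {U : Set E} (hU : IsOpen U)
    (n : ℕ) {f : E → X} (hf : DifferentiableOn ℂ f U) : ContDiffOn ℂ n f U := by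
  induction n generalizing f with
  | zero => exact contDiffOn_zero.2 hf.continuousOn
  | succ n ih =>
    rw [Nat.cast_add, Nat.cast_one, contDiffOn_succ_iff_fderiv_of_isOpen hU]
    exact ⟨hf, fun h => absurd h (by simp),
      contDiffOn_clm_apply.2 fun v => ih (differentiableOn_dirDeriv hU hf v)⟩

theorem dirDeriv_comm [FiniteDimensional ℂ E] {U : Set E} (hU : IsOpen U) {f : E → X}
    (hf : DifferentiableOn ℂ f U) (v w : E) :
    EqOn (dirDeriv v (dirDeriv w f)) (dirDeriv w (dirDeriv v f)) U := fun z hz => by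
  have hcd : ContDiffAt ℂ 2 f z :=
    (contDiffOn_of_differentiableOn hU 2 hf).contDiffAt (hU.mem_nhds hz)
  have hfderiv : DifferentiableAt ℂ (fderiv ℂ f) z :=
    (hcd.fderiv_right (m := 1) (by norm_num)).differentiableAt (by norm_num)
  have hsecond : ∀ v w : E, dirDeriv v (dirDeriv w f) z = fderiv ℂ (fderiv ℂ f) z v w :=
    fun v w => by
      unfold dirDeriv
      simp [fderiv_clm_apply hfderiv (differentiableAt_const w)]
  rw [hsecond, hsecond, (hcd.isSymmSndFDerivAt (by simp)).eq]

end Holomorphic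

section DirDeriv

variable {E X Y : Type*} [NormedAddCommGroup E] [NormedSpace ℂ E]
  [NormedAddCommGroup X] [NormedSpace ℂ X] [NormedAddCommGroup Y] [NormedSpace ℂ Y]
  {U : Set E} {v w : E}

theorem dirDeriv_congr (hU : IsOpen U) {f g : E → X} (h : EqOn f g U) :
    EqOn (dirDeriv v f) (dirDeriv v g) U := fun z hz => by
  rw [dirDeriv, dirDeriv, (h.eventuallyEq_of_mem (hU.mem_nhds hz)).fderiv_eq]

theorem iterate_dirDeriv_congr (hU : IsOpen U) {f g : E → X} (h : EqOn f g U) (a : ℕ) :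
    EqOn ((dirDeriv v)^[a] f) ((dirDeriv v)^[a] g) U := by
  induction a generalizing f g with
  | zero => exact h
  | succ _ ih => exact ih (dirDeriv_congr hU h)

theorem iterate_dirDeriv_zero (a : ℕ) :
    (dirDeriv v)^[a] (fun _ : E => (0 : X)) = fun _ => 0 :=
  Function.iterate_fixed (by funext z; simp [dirDeriv]) a

theorem dirDeriv_add (hU : IsOpen U) {f g : E → X} (hf : DifferentiableOn ℂ f U)
    (hg : DifferentiableOn ℂ g U) :
    EqOn (dirDeriv v fun z => f z + g z) (fun z => dirDeriv v f z + dirDeriv v g z) U :=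
  fun z hz => by
    simp only [dirDeriv, fderiv_fun_add (hf.differentiableAt (hU.mem_nhds hz))
      (hg.differentiableAt (hU.mem_nhds hz)), add_apply]

theorem dirDeriv_sub (hU : IsOpen U) {f g : E → X} (hf : DifferentiableOn ℂ f U)
    (hg : DifferentiableOn ℂ g U) :
    EqOn (dirDeriv v fun z => f z - g z) (fun z => dirDeriv v f z - dirDeriv v g z) U :=
  fun z hz => by
    simp only [dirDeriv, fderiv_fun_sub (hf.differentiableAt (hU.mem_nhds hz))
      (hg.differentiableAt (hU.mem_nhds hz)), sub_apply]

theorem dirDeriv_smul (hU : IsOpen U) {g : E → ℂ} {f : E → X} (hg : DifferentiableOn ℂ g U)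
    (hf : DifferentiableOn ℂ f U) :
    EqOn (dirDeriv v fun z => g z • f z)
      (fun z => dirDeriv v g z • f z + g z • dirDeriv v f z) U := fun z hz => by
  simp [dirDeriv, fderiv_fun_smul (hg.differentiableAt (hU.mem_nhds hz))
    (hf.differentiableAt (hU.mem_nhds hz)), add_comm]

theorem dirDeriv_clm (hU : IsOpen U) {f : E → X} (hf : DifferentiableOn ℂ f U) (L : X →L[ℂ] Y) :
    EqOn (dirDeriv v fun z => L (f z)) (fun z => L (dirDeriv v f z)) U := fun z hz =>
  congrArg (· v) (L.hasFDerivAt.comp z (hf.differentiableAt (hU.mem_nhds hz)).hasFDerivAt).fderiv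

variable [CompleteSpace X] [FiniteDimensional ℂ E]

theorem differentiableOn_iterate_dirDeriv (hU : IsOpen U) {f : E → X}
    (hf : DifferentiableOn ℂ f U) (a : ℕ) : DifferentiableOn ℂ ((dirDeriv v)^[a] f) U := by
  induction a generalizing f with
  | zero => exact hf
  | succ _ ih => exact ih (differentiableOn_dirDeriv hU hf v)

theorem iterate_dirDeriv_add (hU : IsOpen U) {f g : E → X} (hf : DifferentiableOn ℂ f U)
    (hg : DifferentiableOn ℂ g U) (a : ℕ) :
    EqOn ((dirDeriv v)^[a] fun z => f z + g z)
      (fun z => (dirDeriv v)^[a] f z + (dirDeriv v)^[a] g z) U := by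
  induction a generalizing f g with
  | zero => exact fun z _ => rfl
  | succ a ih =>
    exact (iterate_dirDeriv_congr hU (dirDeriv_add hU hf hg) a).trans
      (ih (differentiableOn_dirDeriv hU hf v) (differentiableOn_dirDeriv hU hg v))

theorem iterate_dirDeriv_sub (hU : IsOpen U) {f g : E → X} (hf : DifferentiableOn ℂ f U)
    (hg : DifferentiableOn ℂ g U) (a : ℕ) :
    EqOn ((dirDeriv v)^[a] fun z => f z - g z)
      (fun z => (dirDeriv v)^[a] f z - (dirDeriv v)^[a] g z) U := by
  induction a generalizing f g with
  | zero => exact fun z _ => rfl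
  | succ a ih =>
    exact (iterate_dirDeriv_congr hU (dirDeriv_sub hU hf hg) a).trans
      (ih (differentiableOn_dirDeriv hU hf v) (differentiableOn_dirDeriv hU hg v))

theorem iterate_dirDeriv_clm (hU : IsOpen U) {f : E → X} (hf : DifferentiableOn ℂ f U)
    (L : X →L[ℂ] Y) (a : ℕ) :
    EqOn ((dirDeriv v)^[a] fun z => L (f z)) (fun z => L ((dirDeriv v)^[a] f z)) U := by
  induction a generalizing f with
  | zero => exact fun z _ => rfl
  | succ a ih =>
    exact (iterate_dirDeriv_congr hU (dirDeriv_clm hU hf L) a).trans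
      (ih (differentiableOn_dirDeriv hU hf v))

theorem dirDeriv_iterate_comm (hU : IsOpen U) {f : E → X} (hf : DifferentiableOn ℂ f U) (a : ℕ) :
    EqOn (dirDeriv w ((dirDeriv v)^[a] f)) ((dirDeriv v)^[a] (dirDeriv w f)) U := by
  induction a generalizing f with
  | zero => exact fun z _ => rfl
  | succ a ih =>
    exact (ih (differentiableOn_dirDeriv hU hf v)).trans
      (iterate_dirDeriv_congr hU (dirDeriv_comm hU hf w v) a)

theorem iterate_dirDeriv_succ_smul (hU : IsOpen U) {g : E → ℂ} {f : E → X}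
    (hg : DifferentiableOn ℂ g U) (hf : DifferentiableOn ℂ f U) (a : ℕ) :
    EqOn ((dirDeriv v)^[a + 1] fun z => g z • f z)
      (fun z => (dirDeriv v)^[a] (fun z => dirDeriv v g z • f z) z +
        (dirDeriv v)^[a] (fun z => g z • dirDeriv v f z) z) U :=
  (iterate_dirDeriv_congr hU (dirDeriv_smul hU hg hf) a).trans
    (iterate_dirDeriv_add hU ((differentiableOn_dirDeriv hU hg v).smul hf)
      (hg.smul (differentiableOn_dirDeriv hU hf v)) a)

/- By the Leibniz rule the jet of `g • S` is obtained from that of `S` by a triangular matrix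
depending only on the jet of `g`. -/
theorem clm_iterate_dirDeriv_smul [CompleteSpace Y] (hU : IsOpen U) {g : E → ℂ} {S : E → X}
    {S' : E → Y} (hg : DifferentiableOn ℂ g U) (hS : DifferentiableOn ℂ S U)
    (hS' : DifferentiableOn ℂ S' U) (L : X →L[ℂ] Y) {z : E} (hz : z ∈ U) {a : ℕ}
    (h : ∀ b ≤ a, L ((dirDeriv v)^[b] S z) = (dirDeriv v)^[b] S' z) :
    L ((dirDeriv v)^[a] (fun z => g z • S z) z) = (dirDeriv v)^[a] (fun z => g z • S' z) z := by
  induction a generalizing g S S' with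
  | zero => simpa using congrArg (g z • ·) (h 0 le_rfl)
  | succ a ih =>
    rw [iterate_dirDeriv_succ_smul hU hg hS a hz, iterate_dirDeriv_succ_smul hU hg hS' a hz,
      map_add, ih (differentiableOn_dirDeriv hU hg v) hS hS' fun b hb => h b (by omega),
      ih hg (differentiableOn_dirDeriv hU hS v) (differentiableOn_dirDeriv hU hS' v)
        fun b hb => h (b + 1) (by omega)]

theorem iterate_dirDeriv_smul_eq_zero (hU : IsOpen U) {g : E → ℂ} {f : E → X}
    (hg : DifferentiableOn ℂ g U) (hf : DifferentiableOn ℂ f U) {z : E} (hz : z ∈ U) {a : ℕ}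
    (h : ∀ b ≤ a, (dirDeriv v)^[b] f z = 0) :
    (dirDeriv v)^[a] (fun z => g z • f z) z = 0 := by
  simpa [iterate_dirDeriv_zero] using clm_iterate_dirDeriv_smul (v := v) hU hg hf
    (differentiableOn_const (0 : X)) (ContinuousLinearMap.id ℂ X) hz
    fun b hb => by simpa [iterate_dirDeriv_zero] using h b hb

theorem iterate_dirDeriv_iterate_smul_eq_zero (hU : IsOpen U) {g : E → ℂ} {f : E → X}
    (hg : DifferentiableOn ℂ g U) (hf : DifferentiableOn ℂ f U) {z : E} (hz : z ∈ U) {a b : ℕ}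
    (h : ∀ a' ≤ a, ∀ b' ≤ b, (dirDeriv v)^[a'] ((dirDeriv w)^[b'] f) z = 0) :
    (dirDeriv v)^[a] ((dirDeriv w)^[b] fun z => g z • f z) z = 0 := by
  induction b generalizing g f with
  | zero => exact iterate_dirDeriv_smul_eq_zero hU hg hf hz fun a' ha' => h a' ha' 0 le_rfl
  | succ b ih =>
    have hDg := differentiableOn_dirDeriv hU hg w
    have hDf := differentiableOn_dirDeriv hU hf w
    have hDgf : DifferentiableOn ℂ ((dirDeriv w)^[b] fun z => dirDeriv w g z • f z) U :=
      differentiableOn_iterate_dirDeriv hU (hDg.smul hf) b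
    have hgDf : DifferentiableOn ℂ ((dirDeriv w)^[b] fun z => g z • dirDeriv w f z) U :=
      differentiableOn_iterate_dirDeriv hU (hg.smul hDf) b
    calc (dirDeriv v)^[a] ((dirDeriv w)^[b + 1] fun z => g z • f z) z
        = (dirDeriv v)^[a] ((dirDeriv w)^[b] fun z => dirDeriv w g z • f z) z +
            (dirDeriv v)^[a] ((dirDeriv w)^[b] fun z => g z • dirDeriv w f z) z :=
          ((iterate_dirDeriv_congr hU (iterate_dirDeriv_succ_smul hU hg hf b) a).trans
            (iterate_dirDeriv_add hU hDgf hgDf a)) hz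
      _ = 0 := by
          rw [ih hDg hf fun a' ha' b' hb' => h a' ha' b' (by omega),
            ih hg hDf fun a' ha' b' hb' => h a' ha' (b' + 1) (by omega), add_zero]

end DirDeriv

section Lines

variable {E X : Type*} [NormedAddCommGroup E] [NormedSpace ℂ E]
  [NormedAddCommGroup X] [NormedSpace ℂ X]

theorem tendsto_add_smul (z v : E) : Tendsto (fun t : ℂ => z + t • v) (𝓝 0) (𝓝 z) :=
  Continuous.tendsto' (by fun_prop) _ _ (by simp)

theorem convex_preimage_line {U : Set E} (hU : Convex ℝ U) (z v : E) :
    Convex ℝ ((fun t : ℂ => z + t • v) ⁻¹' U) :=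
  (hU.translate_preimage_right z).linear_preimage
    ((LinearMap.toSpanSingleton ℂ E v).restrictScalars ℝ)

theorem eq_zero_of_frequently_eq_zero_on_line [CompleteSpace X] {U : Set E} (hU : IsOpen U)
    (hconv : Convex ℝ U) {f : E → X} (hf : DifferentiableOn ℂ f U) {z v : E} (hz : z ∈ U) {t : ℂ}
    (ht : z + t • v ∈ U) (h : ∃ᶠ s in 𝓝[≠] (0 : ℂ), f (z + s • v) = 0) : f (z + t • v) = 0 := by
  have hline : Differentiable ℂ fun t : ℂ => z + t • v := by fun_prop
  have han : AnalyticOnNhd ℂ (fun t : ℂ => f (z + t • v)) ((fun t : ℂ => z + t • v) ⁻¹' U) :=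
    (hf.comp hline.differentiableOn fun t ht => ht).analyticOnNhd (hU.preimage hline.continuous)
  have hz' : (0 : ℂ) ∈ (fun t : ℂ => z + t • v) ⁻¹' U := by simpa using hz
  exact han.eqOn_zero_of_preconnected_of_frequently_eq_zero
    (convex_preimage_line hconv z v).isPreconnected hz' h ht

theorem eq_zero_on_slice_of_eventually [CompleteSpace X] {U : Set E} (hU : IsOpen U)
    (hconv : Convex ℝ U) {f : E → X} (hf : DifferentiableOn ℂ f U) {L : Submodule ℂ E} {z₁ z₂ : E}
    (hz₁ : z₁ ∈ U ∩ L) (hz₂ : z₂ ∈ U ∩ L) (h : ∀ᶠ z in 𝓝 z₁, z ∈ L → f z = 0) : f z₂ = 0 := by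
  have hline : z₁ + (1 : ℂ) • (z₂ - z₁) = z₂ := by simp
  have hfreq : ∃ᶠ t in 𝓝[≠] (0 : ℂ), f (z₁ + t • (z₂ - z₁)) = 0 := by
    refine Eventually.frequently (nhdsWithin_le_nhds ?_)
    filter_upwards [(tendsto_add_smul z₁ (z₂ - z₁)).eventually h] with t ht
    exact ht (L.add_mem hz₁.2 (L.smul_mem t (L.sub_mem hz₂.2 hz₁.2)))
  have hz := eq_zero_of_frequently_eq_zero_on_line hU hconv hf hz₁.1 (by rw [hline]; exact hz₂.1)
    hfreq
  rwa [hline] at hz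

theorem dirDeriv_eq_zero_of_forall_add_smul_mem {U W : Set E} (hU : IsOpen U) {f : E → X}
    (hf : DifferentiableOn ℂ f U) {v : E} (hW : ∀ z ∈ W, ∀ t : ℂ, z + t • v ∈ W)
    (h : ∀ z ∈ U ∩ W, f z = 0) : ∀ z ∈ U ∩ W, dirDeriv v f z = 0 := fun z hz => by
  have hderiv := deriv_comp_line (f := f) (z := z) (v := v) (t := 0)
    (by simpa using hf.differentiableAt (hU.mem_nhds hz.1))
  have hzero : (fun t : ℂ => f (z + t • v)) =ᶠ[𝓝 0] fun _ => 0 := by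
    filter_upwards [(tendsto_add_smul z v).eventually (hU.mem_nhds hz.1)] with t ht
    exact h _ ⟨ht, hW z hz.2 t⟩
  rw [zero_smul, add_zero] at hderiv
  rw [← hderiv, hzero.deriv_eq, deriv_const]

theorem iterate_dirDeriv_eq_zero_of_forall_add_smul_mem [CompleteSpace X] [FiniteDimensional ℂ E]
    {U W : Set E} (hU : IsOpen U) {f : E → X} (hf : DifferentiableOn ℂ f U) {v : E}
    (hW : ∀ z ∈ W, ∀ t : ℂ, z + t • v ∈ W) (h : ∀ z ∈ U ∩ W, f z = 0) (a : ℕ) :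
    ∀ z ∈ U ∩ W, (dirDeriv v)^[a] f z = 0 := by
  induction a generalizing f with
  | zero => exact h
  | succ _ ih =>
    exact ih (differentiableOn_dirDeriv hU hf v)
      (dirDeriv_eq_zero_of_forall_add_smul_mem hU hf hW h)

theorem eq_of_dirDeriv_eq_zero_on_line {U : Set E} (hU : IsOpen U) (hconv : Convex ℝ U)
    {f : E → X} (hf : DifferentiableOn ℂ f U) {z v : E} (hz : z ∈ U) (hzv : z + v ∈ U)
    (h : ∀ t : ℂ, z + t • v ∈ U → dirDeriv v f (z + t • v) = 0) : f (z + v) = f z := by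
  have hline : Differentiable ℂ fun t : ℂ => z + t • v := by fun_prop
  have hconst := (hU.preimage hline.continuous).is_const_of_deriv_eq_zero
    (convex_preimage_line hconv z v).isPreconnected
    (hf.comp hline.differentiableOn fun t ht => ht)
    (fun t ht => (deriv_comp_line (hf.differentiableAt (hU.mem_nhds ht))).trans (h t ht))
    (show (1 : ℂ) ∈ _ by simpa using hzv) (show (0 : ℂ) ∈ _ by simpa using hz)
  simpa using hconst

theorem eq_of_dirDeriv_eq_zero_of_sub_mem_span {U T : Set E} (hU : IsOpen U) (hconv : Convex ℝ U)
    {f : E → X} (hf : DifferentiableOn ℂ f U) {z z' : E} (hz : z ∈ U) (hz' : z' ∈ U)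
    (hspan : z' - z ∈ Submodule.span ℂ T)
    (h : ∀ p ∈ U, p - z ∈ Submodule.span ℂ T → ∀ w ∈ T, dirDeriv w f p = 0) : f z' = f z := by
  have key := eq_of_dirDeriv_eq_zero_on_line hU hconv hf hz
    (v := z' - z) (by rwa [add_sub_cancel]) fun t ht => by
      have hT : T ⊆ LinearMap.ker (fderiv ℂ f (z + t • (z' - z)) : E →ₗ[ℂ] X) :=
        h _ ht (by simpa using Submodule.smul_mem _ t hspan)
      exact Submodule.span_le.2 hT hspan
  rwa [add_sub_cancel] at key

end Lines

section Polarization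

variable {E X : Type*} [NormedAddCommGroup E] [StarAddMonoid E]

/-- The domain `U × Ū` of the polarization `Φ(x, y)` of a function `x ↦ Φ(x, x̄)` on `U`. -/
abbrev conjSquare (U : Set E) : Set (E × E) := U ×ˢ (star ⁻¹' U)

theorem isOpen_conjSquare [ContinuousStar E] {U : Set E} (hU : IsOpen U) :
    IsOpen (conjSquare U) :=
  hU.prod (hU.preimage continuous_star)

theorem mk_star_mem_conjSquare {U : Set E} {x : E} (hx : x ∈ U) : (x, star x) ∈ conjSquare U :=
  ⟨hx, by simpa using hx⟩

variable [NormedSpace ℂ E] [StarModule ℂ E]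

theorem convex_conjSquare {U : Set E} (hU : Convex ℝ U) : Convex ℝ (conjSquare U) :=
  hU.prod fun x hx y hy a b ha hb hab => by
    simpa [mem_preimage, star_add, star_smul] using hU hx hy ha hb hab

/- The points `(x, star x)` form a maximal totally real subspace of `E × E`: every pair is
`p + I • p'` with `p` and `p'` in it. -/
theorem mk_eq_mk_star_add_I_smul_mk_star {x y α β : E} (hα : α = (2⁻¹ : ℂ) • (x + star y))
    (hβ : β = (-Complex.I / 2) • (x - star y)) :
    (x, y) = (α, star α) + Complex.I • (β, star β) := by
  have hI : Complex.I * (-Complex.I / 2) = 2⁻¹ := by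
    linear_combination (-1 / 2) * Complex.I_mul_I
  have hI' : Complex.I * star (-Complex.I / 2) = -2⁻¹ := by
    simp only [Complex.star_def, map_div₀, map_neg, Complex.conj_I, map_ofNat]
    linear_combination (1 / 2) * Complex.I_mul_I
  have h2 : star (2⁻¹ : ℂ) = 2⁻¹ := by simp
  refine Prod.ext ?_ ?_
  · simp only [hα, hβ, Prod.fst_add, Prod.smul_fst, smul_smul, hI]
    module
  · simp only [hα, hβ, Prod.snd_add, Prod.smul_snd, star_smul, star_add, star_sub, star_star,
      smul_smul, hI', h2]
    module

theorem eq_zero_of_eq_zero_mk_star [ContinuousStar E] [NormedAddCommGroup X] [NormedSpace ℂ X]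
    [CompleteSpace X] {U : Set E} (hU : IsOpen U) (hconv : Convex ℝ U) (L : Submodule ℂ E)
    {G : E × E → X} (hG : DifferentiableOn ℂ G (conjSquare U))
    (h : ∀ x ∈ U ∩ L, G (x, star x) = 0) {x y : E} (hx : x ∈ U ∩ L) (hy : star y ∈ U ∩ L) :
    G (x, y) = 0 := by
  obtain ⟨α, hα⟩ : ∃ α : E, α = (2⁻¹ : ℂ) • (x + star y) := ⟨_, rfl⟩
  obtain ⟨β, hβ⟩ : ∃ β : E, β = (-Complex.I / 2) • (x - star y) := ⟨_, rfl⟩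
  have hαU : α ∈ U := by
    have := hconv hx.1 hy.1 (a := 2⁻¹) (b := 2⁻¹) (by norm_num) (by norm_num) (by norm_num)
    simpa [hα, ← Complex.coe_smul] using this
  have hαL : α ∈ L := hα ▸ L.smul_mem _ (L.add_mem hx.2 hy.2)
  have hβL : β ∈ L := hβ ▸ L.smul_mem _ (L.sub_mem hx.2 hy.2)
  have hxy := mk_eq_mk_star_add_I_smul_mk_star hα hβ
  rw [hxy]
  refine eq_zero_of_frequently_eq_zero_on_line (isOpen_conjSquare hU) (convex_conjSquare hconv) hG
    (mk_star_mem_conjSquare hαU) (hxy ▸ ⟨hx.1, hy.1⟩) ?_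
  have hofReal : Tendsto (fun t : ℝ => (t : ℂ)) (𝓝[≠] 0) (𝓝[≠] 0) :=
    (Complex.continuous_ofReal.tendsto' 0 0 (by simp)).inf (by simp)
  refine hofReal.frequently (Eventually.frequently (nhdsWithin_le_nhds ?_))
  have hline : Tendsto (fun t : ℝ => α + (t : ℂ) • β) (𝓝 0) (𝓝 α) :=
    (tendsto_add_smul α β).comp (Complex.continuous_ofReal.tendsto' 0 0 (by simp))
  filter_upwards [hline.eventually (hU.mem_nhds hαU)] with t ht
  simpa [star_smul] using h _ ⟨ht, L.add_mem hαL (L.smul_mem _ hβL)⟩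

end Polarization

section Division

variable {E X : Type*} [NormedAddCommGroup E] [NormedSpace ℂ E] [NormedAddCommGroup X]
  [NormedSpace ℂ X] {U : Set E} {ℓ : E →L[ℂ] ℂ} {e : E}

theorem add_smul_mem_of_convex (hconv : Convex ℝ U) (hproj : ∀ x ∈ U, x - ℓ x • e ∈ U) {x : E}
    (hx : x ∈ U) {t : ℝ} (ht : t ∈ Icc (0 : ℝ) 1) : x + (((t : ℂ) - 1) * ℓ x) • e ∈ U := by
  have hcomb := hconv hx (hproj x hx) ht.1 (sub_nonneg.2 ht.2) (by ring)
  convert hcomb using 1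
  rw [← Complex.coe_smul, ← Complex.coe_smul]
  push_cast
  module

variable [CompleteSpace X] [FiniteDimensional ℂ E]

theorem iterate_dirDeriv_succ_clm_smul (hU : IsOpen U) (he : ℓ e = 1) {g : E → X}
    (hg : DifferentiableOn ℂ g U) (a : ℕ) :
    EqOn ((dirDeriv e)^[a + 1] fun x => ℓ x • g x)
      (fun x => ℓ x • (dirDeriv e)^[a + 1] g x + (a + 1 : ℂ) • (dirDeriv e)^[a] g x) U := by
  have hℓ : DifferentiableOn ℂ ℓ U := ℓ.differentiableOn
  have hDℓ : dirDeriv e ℓ = fun _ => 1 := by funext x; simp [dirDeriv, he]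
  induction a generalizing g with
  | zero =>
    intro x hx
    simpa [hDℓ, add_comm] using iterate_dirDeriv_succ_smul (v := e) hU hℓ hg 0 hx
  | succ a ih =>
    intro x hx
    have hx' := ih (differentiableOn_dirDeriv hU hg e) hx
    simp only [← Function.iterate_succ_apply] at hx'
    refine (iterate_dirDeriv_succ_smul hU hℓ hg (a + 1) hx).trans ?_
    simp only [hx', hDℓ, one_smul, Nat.cast_add, Nat.cast_one]
    module

theorem iterate_dirDeriv_clm_pow_smul_eq_zero (hU : IsOpen U) (he : ℓ e = 1) {g : E → X}
    (hg : DifferentiableOn ℂ g U) {a k : ℕ} (ha : a < k) {x : E} (hx : x ∈ U) (hx0 : ℓ x = 0) :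
    (dirDeriv e)^[a] (fun x => ℓ x ^ k • g x) x = 0 := by
  induction k generalizing a with
  | zero => omega
  | succ k ih =>
    have hpow : DifferentiableOn ℂ (fun x => ℓ x ^ k • g x) U :=
      (ℓ.differentiableOn.pow k).smul hg
    simp only [pow_succ', mul_smul]
    cases a with
    | zero => simp [hx0]
    | succ a =>
      rw [iterate_dirDeriv_succ_clm_smul hU he hpow a hx]
      simp only [hx0, zero_smul, zero_add, ih (Nat.lt_of_succ_lt_succ ha), smul_zero]

/- Hadamard's lemma: `f x = ∫₀¹ (d/dt) f (x + (t - 1) ℓ(x) e) dt`, the lower endpoint being the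
projection of `x` to the hyperplane `ℓ = 0`. -/
theorem exists_eq_clm_smul (hU : IsOpen U) (hconv : Convex ℝ U) (he : ℓ e = 1)
    (hproj : ∀ x ∈ U, x - ℓ x • e ∈ U) {f : E → X} (hf : DifferentiableOn ℂ f U)
    (h : ∀ x ∈ U, ℓ x = 0 → f x = 0) :
    ∃ g : E → X, DifferentiableOn ℂ g U ∧ ∀ x ∈ U, f x = ℓ x • g x := by
  let γ (t : ℝ) (x : E) : E := x + (((t : ℂ) - 1) * ℓ x) • e
  have hγ : ∀ t ∈ Icc (0 : ℝ) 1, MapsTo (γ t) U U := fun t ht x hx =>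
    add_smul_mem_of_convex hconv hproj hx ht
  have hD := differentiableOn_dirDeriv hU hf e
  refine ⟨fun x => ∫ t in (0 : ℝ)..1, dirDeriv e f (γ t x), ?_, fun x hx => ?_⟩
  · refine differentiableOn_intervalIntegral hU zero_le_one (fun t ht => ?_) ?_
    · exact hD.comp (by fun_prop) (hγ t ht)
    · exact hD.continuousOn.comp (f := Function.uncurry γ)
        (Continuous.continuousOn (by unfold γ Function.uncurry; fun_prop))
        fun p hp => hγ p.1 hp.1 hp.2
  · have hderiv : ∀ t ∈ Set.uIcc (0 : ℝ) 1,
        HasDerivAt (fun t : ℝ => f (γ t x)) (ℓ x • dirDeriv e f (γ t x)) t := fun t ht => by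
      rw [uIcc_of_le zero_le_one] at ht
      have hcoef : HasDerivAt (fun t : ℝ => ((t : ℂ) - 1) * ℓ x) (ℓ x) t := by
        simpa using (Complex.ofRealCLM.hasDerivAt.sub_const 1).mul_const (ℓ x)
      have hγ' : HasDerivAt (fun t : ℝ => γ t x) (ℓ x • e) t := (hcoef.smul_const e).const_add x
      have hcomp := ((hf.differentiableAt (hU.mem_nhds (hγ t ht hx))).hasFDerivAt.restrictScalars
        ℝ).comp_hasDerivAt t hγ'
      exact hcomp.congr_deriv (map_smul (fderiv ℂ f (γ t x)) (ℓ x) e)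
    have hcont : ContinuousOn (fun t : ℝ => dirDeriv e f (γ t x)) (Icc 0 1) :=
      hD.continuousOn.comp (Continuous.continuousOn (by unfold γ; fun_prop))
        fun t ht => hγ t ht hx
    have hInt := intervalIntegral.integral_eq_sub_of_hasDerivAt hderiv
      ((hcont.const_smul (ℓ x)).intervalIntegrable_of_Icc zero_le_one)
    have hγ1 : γ 1 x = x := by simp [γ]
    have hγ0 : f (γ 0 x) = 0 :=
      h _ (hγ 0 (by simp) hx) (by simp [γ, he])
    rw [intervalIntegral.integral_smul, hγ1, hγ0, sub_zero] at hInt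
    exact hInt.symm

theorem exists_eq_clm_pow_smul (hU : IsOpen U) (hconv : Convex ℝ U) (he : ℓ e = 1)
    (hproj : ∀ x ∈ U, x - ℓ x • e ∈ U) (k : ℕ) {f : E → X} (hf : DifferentiableOn ℂ f U)
    (h : ∀ a < k, ∀ x ∈ U, ℓ x = 0 → (dirDeriv e)^[a] f x = 0) :
    ∃ g : E → X, DifferentiableOn ℂ g U ∧ ∀ x ∈ U, f x = ℓ x ^ k • g x := by
  induction k generalizing f with
  | zero => exact ⟨f, hf, fun x _ => by simp⟩
  | succ k ih =>
    obtain ⟨g₁, hg₁, hfg₁⟩ := exists_eq_clm_smul hU hconv he hproj hf (h 0 k.succ_pos)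
    obtain ⟨g, hg, hg₁g⟩ := ih hg₁ fun a ha x hx hx0 => by
      have hDf := h (a + 1) (Nat.succ_lt_succ ha) x hx hx0
      rw [iterate_dirDeriv_congr hU hfg₁ (a + 1) hx,
        iterate_dirDeriv_succ_clm_smul hU he hg₁ a hx] at hDf
      simp only [hx0, zero_smul, zero_add] at hDf
      exact (smul_eq_zero.1 hDf).resolve_left (Nat.cast_add_one_ne_zero a)
    exact ⟨g, hg, fun x hx => by rw [hfg₁ x hx, hg₁g x hx, smul_smul, pow_succ']⟩

theorem exists_eq_clm_smul_of_fderiv_ne_zero (hU : IsOpen U) (hconv : Convex ℝ U) (he : ℓ e = 1)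
    (hproj : ∀ x ∈ U, x - ℓ x • e ∈ U) {f : E → X} (hf : DifferentiableOn ℂ f U)
    (h : ∀ x ∈ U, ℓ x = 0 → f x = 0) {q : E} (hqU : q ∈ U) (hq : ℓ q = 0)
    (hfq : fderiv ℂ f q ≠ 0) :
    ∃ g : E → X, DifferentiableOn ℂ g U ∧ (∀ x ∈ U, f x = ℓ x • g x) ∧ g q ≠ 0 := by
  obtain ⟨g, hg, hfg⟩ := exists_eq_clm_smul hU hconv he hproj hf h
  refine ⟨g, hg, hfg, fun hgq => hfq ?_⟩
  have hprod := ℓ.hasFDerivAt.smul (hg.differentiableAt (hU.mem_nhds hqU)).hasFDerivAt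
  rw [hq, hgq] at hprod
  have hfg' : f =ᶠ[𝓝 q] fun x => ℓ x • g x := eventually_of_mem (hU.mem_nhds hqU) hfg
  refine (hfg'.fderiv_eq.trans hprod.fderiv).trans ?_
  ext v
  simp

end Division

section Conjugation

variable {E X Y : Type*} [NormedAddCommGroup E] [NormedSpace ℂ E] [StarAddMonoid E]
  [StarModule ℂ E] [ContinuousStar E] [NormedAddCommGroup X] [NormedSpace ℂ X]
  [NormedAddCommGroup Y] [NormedSpace ℂ Y] {U : Set E} {f : E → X}

theorem hasFDerivAt_semilinear_comp_star (σ : X →L⋆[ℂ] Y) {y : E}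
    (hf : DifferentiableAt ℂ f (star y)) :
    HasFDerivAt (fun y => σ (f (star y)))
      (σ.comp ((fderiv ℂ f (star y)).comp (starL ℂ : E ≃L⋆[ℂ] E).toContinuousLinearMap)) y :=
  .comp_semilinear σ (starL ℂ : E ≃L⋆[ℂ] E).toContinuousLinearMap hf.hasFDerivAt

theorem differentiableOn_semilinear_comp_star (hU : IsOpen U) (hf : DifferentiableOn ℂ f U)
    (σ : X →L⋆[ℂ] Y) : DifferentiableOn ℂ (fun y => σ (f (star y))) (star ⁻¹' U) := fun _ hy =>
  (hasFDerivAt_semilinear_comp_star σ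
    (hf.differentiableAt (hU.mem_nhds hy))).differentiableAt.differentiableWithinAt

theorem iterate_dirDeriv_semilinear_comp_star [FiniteDimensional ℂ E] [CompleteSpace X]
    (hU : IsOpen U) (hf : DifferentiableOn ℂ f U) (σ : X →L⋆[ℂ] Y) (v : E) (a : ℕ) :
    EqOn ((dirDeriv v)^[a] fun y => σ (f (star y)))
      (fun y => σ ((dirDeriv (star v))^[a] f (star y))) (star ⁻¹' U) := by
  induction a generalizing f with
  | zero => exact fun y _ => rfl
  | succ a ih =>
    have hstep : EqOn (dirDeriv v fun y => σ (f (star y)))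
        (fun y => σ (dirDeriv (star v) f (star y))) (star ⁻¹' U) := fun y hy => by
      rw [dirDeriv, (hasFDerivAt_semilinear_comp_star σ
        (hf.differentiableAt (hU.mem_nhds hy))).fderiv]
      rfl
    exact (iterate_dirDeriv_congr (hU.preimage continuous_star) hstep a).trans
      (ih (differentiableOn_dirDeriv hU hf _))

end Conjugation

section Pairing

variable {E E' X : Type*} [NormedAddCommGroup E] [NormedSpace ℂ E] [NormedAddCommGroup E']
  [NormedSpace ℂ E'] [NormedAddCommGroup X] [NormedSpace ℂ X] {A : E → X →L[ℂ] ℂ} {T : E' → X}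
  {U : Set E} {U' : Set E'}

theorem differentiableOn_pairing (hA : DifferentiableOn ℂ A U) (hT : DifferentiableOn ℂ T U') :
    DifferentiableOn ℂ (fun p : E × E' => A p.1 (T p.2)) (U ×ˢ U') :=
  (hA.comp differentiableOn_fst fun _ hp => hp.1).clm_apply
    (hT.comp differentiableOn_snd fun _ hp => hp.2)

theorem dirDeriv_pairing (hU : IsOpen U) (hU' : IsOpen U') (hA : DifferentiableOn ℂ A U)
    (hT : DifferentiableOn ℂ T U') (v : E × E') {p : E × E'} (hp : p ∈ U ×ˢ U') :
    dirDeriv v (fun p : E × E' => A p.1 (T p.2)) p =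
      dirDeriv v.1 A p.1 (T p.2) + A p.1 (dirDeriv v.2 T p.2) := by
  have hA' := (hA.differentiableAt (hU.mem_nhds hp.1)).hasFDerivAt.comp p
    (hasFDerivAt_fst (𝕜 := ℂ) (p := p))
  have hT' := (hT.differentiableAt (hU'.mem_nhds hp.2)).hasFDerivAt.comp p
    (hasFDerivAt_snd (𝕜 := ℂ) (p := p))
  calc _ = A p.1 (dirDeriv v.2 T p.2) + dirDeriv v.1 A p.1 (T p.2) :=
        congrArg (fun D => D v) (hA'.clm_apply hT').fderiv
    _ = _ := add_comm _ _

variable [CompleteSpace X] [FiniteDimensional ℂ E] [FiniteDimensional ℂ E']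

theorem iterate_dirDeriv_pairing (hU : IsOpen U) (hU' : IsOpen U') (hA : DifferentiableOn ℂ A U)
    (hT : DifferentiableOn ℂ T U') (v : E) (w : E') (a b : ℕ) :
    EqOn ((dirDeriv ((0, w) : E × E'))^[b] ((dirDeriv ((v, 0) : E × E'))^[a]
      fun p : E × E' => A p.1 (T p.2)))
      (fun p => (dirDeriv v)^[a] A p.1 ((dirDeriv w)^[b] T p.2)) (U ×ˢ U') := by
  have hUU' := hU.prod hU'
  induction a generalizing A with
  | zero =>
    induction b generalizing T with
    | zero => exact fun p _ => rfl
    | succ b ih =>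
      refine (iterate_dirDeriv_congr hUU' (fun p hp => ?_) b).trans
        (ih (differentiableOn_dirDeriv hU' hT w))
      simpa [dirDeriv] using dirDeriv_pairing hU hU' hA hT ((0, w) : E × E') hp
  | succ a ih =>
    refine (iterate_dirDeriv_congr hUU' (iterate_dirDeriv_congr hUU' (fun p hp => ?_) a) b).trans
      (ih (differentiableOn_dirDeriv hU hA v))
    simpa [dirDeriv] using dirDeriv_pairing hU hU' hA hT ((v, 0) : E × E') hp

end Pairing

section Wirtinger

variable {m : ℕ} {U : Set (Fin m → ℂ)} {F G : (Fin m → ℂ) → ℂ}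
  {Φ : (Fin m → ℂ) × (Fin m → ℂ) → ℂ} {x : Fin m → ℂ}

/-- The function `x ↦ Φ(x, x̄)` of which the holomorphic function `Φ` is the polarization. -/
def antidiag (Φ : (Fin m → ℂ) × (Fin m → ℂ) → ℂ) : (Fin m → ℂ) → ℂ := fun x => Φ (x, star x)

theorem star_single_one (j : Fin m) : star (Pi.single j 1 : Fin m → ℂ) = Pi.single j 1 := by
  rw [← Pi.single_star, star_one]

theorem fderiv_antidiag_smul (h : DifferentiableAt ℂ Φ (x, star x)) (c : ℂ) (v : Fin m → ℂ) :
    fderiv ℝ (antidiag Φ) x (c • v) =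
      c * dirDeriv (v, 0) Φ (x, star x) + star c * dirDeriv (0, star v) Φ (x, star x) := by
  have hgraph : HasFDerivAt (fun x : Fin m → ℂ => (x, star x))
      ((ContinuousLinearMap.id ℝ (Fin m → ℂ)).prod
        ((starL' ℝ : (Fin m → ℂ) ≃L[ℝ] (Fin m → ℂ)) : (Fin m → ℂ) →L[ℝ] (Fin m → ℂ))) x :=
    (hasFDerivAt_id x).prodMk (starL' ℝ : (Fin m → ℂ) ≃L[ℝ] (Fin m → ℂ)).hasFDerivAt
  have hsplit : (c • v, star (c • v)) =
      c • ((v, 0) : (Fin m → ℂ) × (Fin m → ℂ)) + star c • ((0, star v) : _ × (Fin m → ℂ)) := by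
    simp
  calc fderiv ℝ (antidiag Φ) x (c • v) = fderiv ℂ Φ (x, star x) (c • v, star (c • v)) :=
        congrArg (fun D => D (c • v)) ((h.hasFDerivAt.restrictScalars ℝ).comp x hgraph).fderiv
    _ = _ := by rw [hsplit, map_add, map_smul, map_smul]; rfl

theorem fderiv_antidiag_single_one (h : DifferentiableAt ℂ Φ (x, star x)) (j : Fin m) :
    fderiv ℝ (antidiag Φ) x (Pi.single j 1) =
      dirDeriv (Pi.single j 1, 0) Φ (x, star x) + dirDeriv (0, Pi.single j 1) Φ (x, star x) := by
  simpa [star_single_one] using fderiv_antidiag_smul h 1 (Pi.single j 1)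

theorem fderiv_antidiag_single_I (h : DifferentiableAt ℂ Φ (x, star x)) (j : Fin m) :
    fderiv ℝ (antidiag Φ) x (Pi.single j Complex.I) =
      Complex.I * dirDeriv (Pi.single j 1, 0) Φ (x, star x) -
        Complex.I * dirDeriv (0, Pi.single j 1) Φ (x, star x) := by
  have hI : (Pi.single j Complex.I : Fin m → ℂ) = Complex.I • Pi.single j 1 := by
    rw [← Pi.single_smul, smul_eq_mul, mul_one]
  rw [hI, fderiv_antidiag_smul h, star_single_one]
  simp [sub_eq_add_neg]

theorem del_antidiag (h : DifferentiableAt ℂ Φ (x, star x)) (j : Fin m) :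
    del j (antidiag Φ) x = antidiag (dirDeriv (Pi.single j 1, 0) Φ) x := by
  rw [del, fderiv_antidiag_single_one h, fderiv_antidiag_single_I h, antidiag]
  linear_combination (-(1 / 2) * dirDeriv (Pi.single j 1, 0) Φ (x, star x) +
    (1 / 2) * dirDeriv (0, Pi.single j 1) Φ (x, star x)) * Complex.I_mul_I

theorem delBar_antidiag (h : DifferentiableAt ℂ Φ (x, star x)) (j : Fin m) :
    delBar j (antidiag Φ) x = antidiag (dirDeriv (0, Pi.single j 1) Φ) x := by
  rw [delBar, fderiv_antidiag_single_one h, fderiv_antidiag_single_I h, antidiag]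
  linear_combination ((1 / 2) * dirDeriv (Pi.single j 1, 0) Φ (x, star x) -
    (1 / 2) * dirDeriv (0, Pi.single j 1) Φ (x, star x)) * Complex.I_mul_I

theorem del_congr (hU : IsOpen U) (h : EqOn F G U) (j : Fin m) :
    EqOn (del j F) (del j G) U := fun z hz => by
  rw [del, del, (h.eventuallyEq_of_mem (hU.mem_nhds hz)).fderiv_eq]

theorem delBar_congr (hU : IsOpen U) (h : EqOn F G U) (j : Fin m) :
    EqOn (delBar j F) (delBar j G) U := fun z hz => by
  rw [delBar, delBar, (h.eventuallyEq_of_mem (hU.mem_nhds hz)).fderiv_eq]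

theorem iterate_del_antidiag (hU : IsOpen U) (hΦ : DifferentiableOn ℂ Φ (conjSquare U))
    (h : EqOn F (antidiag Φ) U) (j : Fin m) (a : ℕ) :
    EqOn ((del j)^[a] F) (antidiag ((dirDeriv (Pi.single j 1, 0))^[a] Φ)) U := by
  have hUU := isOpen_conjSquare hU
  induction a generalizing F Φ with
  | zero => exact h
  | succ _ ih =>
    exact ih (differentiableOn_dirDeriv hUU hΦ _) <| (del_congr hU h j).trans fun _ hx =>
      del_antidiag (hΦ.differentiableAt (hUU.mem_nhds (mk_star_mem_conjSquare hx))) j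

theorem iterate_delBar_antidiag (hU : IsOpen U) (hΦ : DifferentiableOn ℂ Φ (conjSquare U))
    (h : EqOn F (antidiag Φ) U) (j : Fin m) (a : ℕ) :
    EqOn ((delBar j)^[a] F) (antidiag ((dirDeriv (0, Pi.single j 1))^[a] Φ)) U := by
  have hUU := isOpen_conjSquare hU
  induction a generalizing F Φ with
  | zero => exact h
  | succ _ ih =>
    exact ih (differentiableOn_dirDeriv hUU hΦ _) <| (delBar_congr hU h j).trans fun _ hx =>
      delBar_antidiag (hΦ.differentiableAt (hUU.mem_nhds (mk_star_mem_conjSquare hx))) j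

end Wirtinger

section Slice

variable {n : ℕ} {q : Fin (n + 1) → ℂ} {r : ℝ}

/-- The coordinate vector normal to the hypersurface in an adapted chart. -/
abbrev e₀ : Fin (n + 1) → ℂ := Pi.single 0 1

/-- The first coordinate, whose zero set is the hypersurface in an adapted chart. -/
abbrev coord₀ : (Fin (n + 1) → ℂ) →L[ℂ] ℂ := ContinuousLinearMap.proj 0

/-- The image of the hypersurface in an adapted chart, as a subspace of the coordinate space. -/
abbrev slice (n : ℕ) : Submodule ℂ (Fin (n + 1) → ℂ) := coord₀.ker

theorem coord₀_e₀ : coord₀ (e₀ : Fin (n + 1) → ℂ) = 1 := by simp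

theorem star_e₀ : star (e₀ : Fin (n + 1) → ℂ) = e₀ := star_single_one 0

theorem sub_smul_e₀_mem_ball (hq : q 0 = 0) : ∀ x ∈ ball q r, x - coord₀ x • e₀ ∈ ball q r := by
  intro x hx
  have hr : 0 < r := pos_of_mem_ball hx
  rw [mem_ball, dist_pi_lt_iff hr] at hx ⊢
  refine Fin.cases (by simpa [hq] using hr) fun j => ?_
  simpa using hx j.succ

end Slice

section Module

namespace QuasiFreeModule

variable {m : ℕ} {Ω Z : Set (Fin m → ℂ)} {H : Type*} [NormedAddCommGroup H]
  [InnerProductSpace ℂ H] [CompleteSpace H] (M : QuasiFreeModule Ω H)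

theorem toFun_of_mem (h : H) {w : Fin m → ℂ} (hw : w ∈ Ω) : M.toFun h w = M.eval ⟨w, hw⟩ h :=
  dif_pos hw

theorem inner_kernelVec (w : Ω) (h : H) : ⟪M.kernelVec w, h⟫_ℂ = M.eval w h := by
  simp [kernelVec]

theorem eval_act (f : funAlg Ω) (w : Ω) (h : H) :
    M.eval w (M.act f h) = evalAlg w f * M.eval w h := by
  refine congrFun (M.denseRange_incl.equalizer (g := fun h => M.eval w (M.act f h))
    (h := fun h => evalAlg w f * M.eval w h) (by fun_prop) (by fun_prop) ?_) h
  funext g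
  simp only [Function.comp_apply, act_incl, eval_incl]
  rfl

/-- The constant function `1`, which generates the module. -/
def one : H := M.incl 1

theorem eval_one (w : Ω) : M.eval w M.one = 1 := by
  rw [one, eval_incl]; rfl

theorem act_one (f : funAlg Ω) : M.act f M.one = M.incl f := by
  rw [one, act_incl, mul_one]

theorem toFun_act (f : funAlg Ω) (h : H) (w : Fin m → ℂ) :
    M.toFun (M.act f h) w = M.toFun (M.incl f) w * M.toFun h w := by
  by_cases hw : w ∈ Ω
  · simp only [toFun_of_mem _ _ hw, eval_act, eval_incl]
  · simp [toFun, hw]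

variable {M}

theorem eq_inner_one_smul_kernelVec {w : Ω} {v : H}
    (hv : v ∈ Submodule.span ℂ {M.kernelVec w}) : v = ⟪M.one, v⟫_ℂ • M.kernelVec w := by
  obtain ⟨c, rfl⟩ := Submodule.mem_span_singleton.1 hv
  rw [inner_smul_right, ← inner_conj_symm, inner_kernelVec, eval_one, map_one, mul_one]

theorem inner_one_ne_zero {w : Ω} {v : H} (hv : v ∈ Submodule.span ℂ {M.kernelVec w})
    (h0 : v ≠ 0) : ⟪M.one, v⟫_ℂ ≠ 0 := fun h => h0 <| by
  rw [eq_inner_one_smul_kernelVec hv, h, zero_smul]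

theorem inner_eq_of_mem_fibre {w : Ω} {v : H} (hv : v ∈ Submodule.span ℂ {M.kernelVec w})
    (h : H) : ⟪h, v⟫_ℂ = ⟪M.one, v⟫_ℂ * star (M.eval w h) := by
  conv_lhs => rw [eq_inner_one_smul_kernelVec hv]
  rw [inner_smul_right, ← inner_conj_symm h, inner_kernelVec]
  rfl

theorem inner_act_of_mem_fibre {w : Ω} {v : H} (hv : v ∈ Submodule.span ℂ {M.kernelVec w})
    (f : funAlg Ω) (h : H) : ⟪M.act f h, v⟫_ℂ = star (evalAlg w f) * ⟪h, v⟫_ℂ := by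
  rw [inner_eq_of_mem_fibre hv (M.act f h), inner_eq_of_mem_fibre hv h, eval_act, star_mul']
  ring

variable (M) in
/-- A holomorphic frame of the line bundle of the module pulled back along the parametrisation `ψ`
of an open subset of `Ω`. As in `IsFrame`, the base of the bundle is conjugated. -/
structure IsLocalFrame (ψ : (Fin m → ℂ) → Fin m → ℂ) (U : Set (Fin m → ℂ))
    (S : (Fin m → ℂ) → H) : Prop where
  isOpen : IsOpen U
  differentiableOn : DifferentiableOn ℂ S (star ⁻¹' U)
  mem_fibre : ∀ y, star y ∈ U → ∃ hy : ψ (star y) ∈ Ω,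
    S y ∈ Submodule.span ℂ {M.kernelVec ⟨ψ (star y), hy⟩}
  ne_zero : ∀ y, star y ∈ U → S y ≠ 0

theorem IsFrame.isLocalFrame {s : (Fin m → ℂ) → H} (hs : M.IsFrame s)
    {ψ : (Fin m → ℂ) → Fin m → ℂ} {U : Set (Fin m → ℂ)} (hU : IsOpen U)
    (hψ : DifferentiableOn ℂ ψ U) (hψU : MapsTo ψ U Ω) :
    M.IsLocalFrame ψ U fun y => s (star (ψ (star y))) where
  isOpen := hU
  differentiableOn := hs.differentiableOn.comp
    (differentiableOn_semilinear_comp_star hU hψ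
      (starL ℂ : (Fin m → ℂ) ≃L⋆[ℂ] (Fin m → ℂ)).toContinuousLinearMap)
    fun y hy => by simpa [Set.mem_ofPred_eq] using hψU hy
  mem_fibre y hy := ⟨hψU hy, hs.mem_fibre ⟨_, hψU hy⟩⟩
  ne_zero y hy := hs.ne_zero ⟨_, hψU hy⟩

namespace IsLocalFrame

variable {ψ : (Fin m → ℂ) → Fin m → ℂ} {U V : Set (Fin m → ℂ)} {S : (Fin m → ℂ) → H}
  (hS : M.IsLocalFrame ψ U S) {y : Fin m → ℂ}
include hS

theorem isOpen_preimage_star : IsOpen (star ⁻¹' U) :=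
  hS.isOpen.preimage continuous_star

theorem mono (hV : IsOpen V) (hVU : V ⊆ U) : M.IsLocalFrame ψ V S where
  isOpen := hV
  differentiableOn := hS.differentiableOn.mono (preimage_mono hVU)
  mem_fibre y hy := hS.mem_fibre y (hVU hy)
  ne_zero y hy := hS.ne_zero y (hVU hy)

theorem smul {χ : (Fin m → ℂ) → ℂ} (hχ : DifferentiableOn ℂ χ (star ⁻¹' U))
    (h0 : ∀ y ∈ star ⁻¹' U, χ y ≠ 0) : M.IsLocalFrame ψ U fun y => χ y • S y where
  isOpen := hS.isOpen
  differentiableOn := hχ.smul hS.differentiableOn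
  mem_fibre y hy := (hS.mem_fibre y hy).imp fun _ h => Submodule.smul_mem _ _ h
  ne_zero y hy := smul_ne_zero (h0 y hy) (hS.ne_zero y hy)

theorem inner_one_ne_zero (hy : star y ∈ U) : ⟪M.one, S y⟫_ℂ ≠ 0 :=
  QuasiFreeModule.inner_one_ne_zero (hS.mem_fibre y hy).2 (hS.ne_zero y hy)

theorem inner_eq (hy : star y ∈ U) (h : H) :
    ⟪h, S y⟫_ℂ = ⟪M.one, S y⟫_ℂ * star (M.toFun h (ψ (star y))) := by
  obtain ⟨hw, hv⟩ := hS.mem_fibre y hy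
  rw [toFun_of_mem _ _ hw, inner_eq_of_mem_fibre hv]

theorem inner_act (hy : star y ∈ U) (f : funAlg Ω) (h : H) :
    ⟪M.act f h, S y⟫_ℂ = star (M.toFun (M.incl f) (ψ (star y))) * ⟪h, S y⟫_ℂ := by
  obtain ⟨hw, hv⟩ := hS.mem_fibre y hy
  rw [toFun_of_mem _ _ hw, eval_incl, inner_act_of_mem_fibre hv]

theorem differentiableOn_inner (h : H) :
    DifferentiableOn ℂ (fun y => ⟪h, S y⟫_ℂ) (star ⁻¹' U) :=
  (innerSL ℂ h).differentiable.comp_differentiableOn hS.differentiableOn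

theorem star_toFun_eq (hy : star y ∈ U) (h : H) :
    star (M.toFun h (ψ (star y))) = (⟪M.one, S y⟫_ℂ)⁻¹ * ⟪h, S y⟫_ℂ := by
  rw [hS.inner_eq hy h, inv_mul_cancel_left₀ (hS.inner_one_ne_zero hy)]

theorem differentiableOn_inv_inner_one :
    DifferentiableOn ℂ (fun y => (⟪M.one, S y⟫_ℂ)⁻¹) (star ⁻¹' U) :=
  (hS.differentiableOn_inner M.one).fun_inv fun _ hy => hS.inner_one_ne_zero hy

theorem differentiableOn_star_toFun (h : H) :
    DifferentiableOn ℂ (fun y => star (M.toFun h (ψ (star y)))) (star ⁻¹' U) :=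
  (hS.differentiableOn_inv_inner_one.fun_mul (hS.differentiableOn_inner h)).congr
    fun _ hy => hS.star_toFun_eq hy h

theorem differentiableOn_toFun (h : H) : DifferentiableOn ℂ (fun x => M.toFun h (ψ x)) U := by
  have hconj := differentiableOn_semilinear_comp_star hS.isOpen_preimage_star
    (hS.differentiableOn_star_toFun h) (starL ℂ : ℂ ≃L⋆[ℂ] ℂ).toContinuousLinearMap
  simp only [← preimage_comp, star_involutive.comp_self, preimage_id] at hconj
  refine hconj.congr fun x _ => ?_
  change _ = star (star (M.toFun h (ψ (star (star x)))))
  rw [star_star, star_star]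

theorem inner_iterate_dirDeriv (hy : star y ∈ U) (h : H) (v : Fin m → ℂ) (a : ℕ) :
    ⟪h, (dirDeriv v)^[a] S y⟫_ℂ = (dirDeriv v)^[a] (fun y => ⟪h, S y⟫_ℂ) y :=
  (iterate_dirDeriv_clm hS.isOpen_preimage_star hS.differentiableOn (innerSL ℂ h) a hy).symm

theorem inner_act_iterate_dirDeriv (hy : star y ∈ U) (f : funAlg Ω) (h : H) (v : Fin m → ℂ)
    (a : ℕ) : ⟪M.act f h, (dirDeriv v)^[a] S y⟫_ℂ =
      ⟪h, (dirDeriv v)^[a] (fun y => star (M.toFun (M.incl f) (ψ (star y))) • S y) y⟫_ℂ := by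
  have hfS : EqOn (fun y => ⟪M.act f h, S y⟫_ℂ)
      (fun y => innerSL ℂ h (star (M.toFun (M.incl f) (ψ (star y))) • S y)) (star ⁻¹' U) :=
    fun y hy => by simpa [inner_smul_right] using hS.inner_act hy f h
  rw [hS.inner_iterate_dirDeriv hy, iterate_dirDeriv_congr hS.isOpen_preimage_star hfS a hy]
  exact iterate_dirDeriv_clm hS.isOpen_preimage_star
    ((hS.differentiableOn_star_toFun _).fun_smul hS.differentiableOn) (innerSL ℂ h) a hy

end IsLocalFrame

theorem IsFrame.differentiableOn_toFun {s : (Fin m → ℂ) → H} (hs : M.IsFrame s) (hΩ : IsOpen Ω)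
    (h : H) : DifferentiableOn ℂ (M.toFun h) Ω :=
  (hs.isLocalFrame hΩ differentiableOn_id (mapsTo_id Ω)).differentiableOn_toFun h

theorem IsFrame.act_mem_vanishing {s : (Fin m → ℂ) → H} (hs : M.IsFrame s) (hΩ : IsOpen Ω)
    (hZ : Z ⊆ Ω) {k : ℕ} (f : funAlg Ω) {h : H} (hh : h ∈ M.vanishing Z k) :
    M.act f h ∈ M.vanishing Z k := by
  intro p hp U φ hpU hφ
  obtain ⟨V, hVU, hpV, hV, g, hg, hhg⟩ := hh p hp U φ hpU hφ
  refine ⟨V ∩ Ω, inter_subset_left.trans hVU, ⟨hpV, hZ hp⟩, hV.inter hΩ,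
    fun z => M.toFun (M.incl f) z * g z, ?_, fun z hz => ?_⟩
  · exact ((hs.differentiableOn_toFun hΩ _).mono inter_subset_right).mul
      (hg.mono inter_subset_left)
  · rw [toFun_act, hhg z hz.1]
    ring

theorem IsFrame.act_mem_orthogonal_quotient {s : (Fin m → ℂ) → H} (hs : M.IsFrame s)
    (hΩ : IsOpen Ω) (hZ : Z ⊆ Ω) {k : ℕ} (f : funAlg Ω) {h : H}
    (hh : h ∈ (M.quotient Z k)ᗮ) : M.act f h ∈ (M.quotient Z k)ᗮ := by
  rw [quotient, Submodule.orthogonal_orthogonal_eq_closure, ← SetLike.mem_coe,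
    Submodule.topologicalClosure_coe] at hh ⊢
  exact map_mem_closure (M.act f).continuous hh fun x hx => hs.act_mem_vanishing hΩ hZ f hx

end QuasiFreeModule

end Module

section Charts

variable {E X : Type*} [NormedAddCommGroup E] [NormedSpace ℂ E] [NormedAddCommGroup X]
  [NormedSpace ℂ X]

theorem fderiv_comp_symm_ne_zero {e : OpenPartialHomeomorph E E}
    (he : DifferentiableOn ℂ e e.source) (he' : DifferentiableOn ℂ e.symm e.target) {f : E → X}
    {x : E} (hx : x ∈ e.target) (hf : DifferentiableAt ℂ f (e.symm x))
    (hfx : fderiv ℂ f (e.symm x) ≠ 0) : fderiv ℂ (fun x => f (e.symm x)) x ≠ 0 := by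
  intro h0
  refine hfx ?_
  have hsource := e.open_source.mem_nhds (e.map_target hx)
  have hinv : f =ᶠ[𝓝 (e.symm x)] (fun x => f (e.symm x)) ∘ e := by
    filter_upwards [hsource] with z hz
    simp [e.left_inv hz]
  have hcomp : DifferentiableAt ℂ (fun x => f (e.symm x)) (e (e.symm x)) := by
    rw [e.right_inv hx]
    exact hf.comp x (he'.differentiableAt (e.open_target.mem_nhds hx))
  rw [hinv.fderiv_eq, fderiv_comp _ hcomp (he.differentiableAt hsource), e.right_inv hx, h0,
    ContinuousLinearMap.zero_comp]

end Charts

section Vanishing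

variable {n k : ℕ} {Ω Z : Set (Fin (n + 1) → ℂ)}
  {e : OpenPartialHomeomorph (Fin (n + 1) → ℂ) (Fin (n + 1) → ℂ)}
  {f : (Fin (n + 1) → ℂ) → ℂ} {q : Fin (n + 1) → ℂ} {r : ℝ}

namespace IsAdaptedChart

variable (he : IsAdaptedChart Ω Z e)
include he

theorem symm_mem_iff {x : Fin (n + 1) → ℂ} (hx : x ∈ e.target) : e.symm x ∈ Z ↔ x 0 = 0 := by
  rw [he.mem_iff _ (e.map_target hx), e.right_inv hx]

theorem symm_mem {x : Fin (n + 1) → ℂ} (hx : x ∈ e.target) : e.symm x ∈ Ω :=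
  he.source_subset (e.map_target hx)

theorem isLocalDefiningFunction : IsLocalDefiningFunction Z e.source fun z => e z 0 where
  isOpen := e.open_source
  differentiableOn := differentiableOn_pi.1 he.differentiableOn 0
  mem_iff := he.mem_iff
  fderiv_ne_zero z hz := by
    refine fderiv_comp_symm_ne_zero (e := e.symm) (f := coord₀) he.differentiableOn_symm
      he.differentiableOn hz.1 coord₀.differentiableAt fun h0 => ?_
    rw [ContinuousLinearMap.fderiv] at h0
    simpa [h0] using coord₀_e₀ (n := n)

theorem exists_eq_coord_mul {U : Set (Fin (n + 1) → ℂ)} {φ : (Fin (n + 1) → ℂ) → ℂ}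
    (hφ : IsLocalDefiningFunction Z U φ) (hqe : q ∈ e.target) (hq : q 0 = 0)
    (hqU : e.symm q ∈ U) :
    ∃ W ⊆ e.target ∩ e.symm ⁻¹' U, IsOpen W ∧ q ∈ W ∧ ∃ u : (Fin (n + 1) → ℂ) → ℂ,
      DifferentiableOn ℂ u W ∧ ∀ x ∈ W, u x ≠ 0 ∧ φ (e.symm x) = x 0 * u x := by
  obtain ⟨δ, hδ, hδU⟩ := Metric.isOpen_iff.1 (e.isOpen_inter_preimage_symm hφ.isOpen) q ⟨hqe, hqU⟩
  have hφe : DifferentiableOn ℂ (fun x => φ (e.symm x)) (ball q δ) :=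
    hφ.differentiableOn.comp (he.differentiableOn_symm.mono fun x hx => (hδU hx).1)
      fun x hx => (hδU hx).2
  have hslice : ∀ x ∈ ball q δ, coord₀ x = 0 → φ (e.symm x) = 0 := fun x hx hx0 =>
    (hφ.mem_iff _ (hδU hx).2).1 ((he.symm_mem_iff (hδU hx).1).2 hx0)
  obtain ⟨u, hu, hφu, huq⟩ := exists_eq_clm_smul_of_fderiv_ne_zero isOpen_ball (convex_ball q δ)
    coord₀_e₀ (sub_smul_e₀_mem_ball hq) hφe hslice (mem_ball_self hδ) hq
    (fderiv_comp_symm_ne_zero he.differentiableOn he.differentiableOn_symm hqe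
      (hφ.differentiableOn.differentiableAt (hφ.isOpen.mem_nhds hqU))
      (hφ.fderiv_ne_zero _ ⟨hqU, (he.symm_mem_iff hqe).2 hq⟩))
  exact ⟨ball q δ ∩ u ⁻¹' {0}ᶜ, inter_subset_left.trans hδU,
    hu.continuousOn.isOpen_inter_preimage isOpen_ball isOpen_compl_singleton,
    ⟨mem_ball_self hδ, huq⟩, u, hu.mono inter_subset_left, fun x hx => ⟨hx.2, hφu x hx.1⟩⟩

end IsAdaptedChart

/-- The condition that `VanishesToOrder Z k f` imposes at the point `p` of `Z`. -/
def VanishesAt (Z : Set (Fin (n + 1) → ℂ)) (k : ℕ) (f : (Fin (n + 1) → ℂ) → ℂ)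
    (p : Fin (n + 1) → ℂ) : Prop :=
  ∀ U φ, p ∈ U → IsLocalDefiningFunction Z U φ →
    ∃ V ⊆ U, p ∈ V ∧ IsOpen V ∧ ∃ g, DifferentiableOn ℂ g V ∧ ∀ z ∈ V, f z = φ z ^ k * g z

theorem vanishesAt_of_eq_coord_pow_mul (he : IsAdaptedChart Ω Z e) {U : Set (Fin (n + 1) → ℂ)}
    (hU : IsOpen U) (hUe : U ⊆ e.target) (hqU : q ∈ U) (hq : q 0 = 0)
    {g : (Fin (n + 1) → ℂ) → ℂ} (hg : DifferentiableOn ℂ g U)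
    (hfg : ∀ x ∈ U, f (e.symm x) = x 0 ^ k * g x) : VanishesAt Z k f (e.symm q) := by
  intro U' φ hqU' hφ
  obtain ⟨W, hWU', hW, hqW, u, hu, hφu⟩ := he.exists_eq_coord_mul hφ (hUe hqU) hq hqU'
  have hu0 : ∀ x ∈ W, u x ≠ 0 := fun x hx => (hφu x hx).1
  have hde : DifferentiableOn ℂ e (e.source ∩ e ⁻¹' (U ∩ W)) :=
    he.differentiableOn.mono inter_subset_left
  have hsub : e.source ∩ e ⁻¹' (U ∩ W) ⊆ U' := fun z hz => by
    simpa only [mem_preimage, e.left_inv hz.1] using (hWU' hz.2.2).2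
  refine ⟨_, hsub, ?_, e.isOpen_inter_preimage (hU.inter hW), fun z => g (e z) * (u (e z) ^ k)⁻¹,
    ?_, fun z hz => ?_⟩
  · exact ⟨e.map_target (hUe hqU), by rw [mem_preimage, e.right_inv (hUe hqU)]; exact ⟨hqU, hqW⟩⟩
  · have hue : DifferentiableOn ℂ (fun z => u (e z)) (e.source ∩ e ⁻¹' (U ∩ W)) :=
      hu.comp hde fun z hz => hz.2.2
    exact (hg.comp hde fun z hz => hz.2.1).fun_mul
      ((hue.fun_pow k).fun_inv fun z hz => pow_ne_zero k (hu0 _ hz.2.2))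
  · have hfz := hfg (e z) hz.2.1
    have hφz := (hφu (e z) hz.2.2).2
    have huz := hu0 _ hz.2.2
    rw [e.left_inv hz.1] at hfz hφz
    rw [hfz, hφz, mul_pow]
    field_simp

theorem vanishesAt_of_iterate_dirDeriv_eq_zero (he : IsAdaptedChart Ω Z e) (hr : 0 < r)
    (hq : q 0 = 0) (hball : ball q r ⊆ e.target)
    (hf : DifferentiableOn ℂ (fun x => f (e.symm x)) (ball q r))
    (h : ∀ a < k, ∀ x ∈ ball q r, x 0 = 0 → (dirDeriv e₀)^[a] (fun x => f (e.symm x)) x = 0) :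
    VanishesAt Z k f (e.symm q) := by
  obtain ⟨g, hg, hfg⟩ := exists_eq_clm_pow_smul isOpen_ball (convex_ball q r) coord₀_e₀
    (sub_smul_e₀_mem_ball hq) k hf h
  exact vanishesAt_of_eq_coord_pow_mul he isOpen_ball hball (mem_ball_self hr) hq hg hfg

namespace VanishesAt

theorem eventually_iterate_dirDeriv_eq_zero (he : IsAdaptedChart Ω Z e) (hq : q ∈ e.target)
    (h : VanishesAt Z k f (e.symm q)) :
    ∀ᶠ x in 𝓝 q, x 0 = 0 → ∀ a < k, (dirDeriv e₀)^[a] (fun x => f (e.symm x)) x = 0 := by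
  obtain ⟨V, -, hqV, hV, g, hg, hfg⟩ := h e.source _ (e.map_target hq) he.isLocalDefiningFunction
  have hW : IsOpen (e.target ∩ e.symm ⁻¹' V) := e.isOpen_inter_preimage_symm hV
  have hge : DifferentiableOn ℂ (fun x => g (e.symm x)) (e.target ∩ e.symm ⁻¹' V) :=
    hg.comp (he.differentiableOn_symm.mono inter_subset_left) fun x hx => hx.2
  have hfe : EqOn (fun x => f (e.symm x)) (fun x => coord₀ x ^ k • g (e.symm x))
      (e.target ∩ e.symm ⁻¹' V) := fun x hx => by
    simpa [e.right_inv hx.1] using hfg _ hx.2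
  filter_upwards [hW.mem_nhds ⟨hq, hqV⟩] with x hx hx0 a ha
  rw [iterate_dirDeriv_congr hW hfe a hx]
  exact iterate_dirDeriv_clm_pow_smul_eq_zero hW coord₀_e₀ hge ha hx hx0

theorem of_mem_ball (he : IsAdaptedChart Ω Z e) (hball : ball q r ⊆ e.target)
    (hf : DifferentiableOn ℂ (fun x => f (e.symm x)) (ball q r)) {x y : Fin (n + 1) → ℂ}
    (hx : x ∈ ball q r) (hy : y ∈ ball q r) (hx0 : x 0 = 0) (hy0 : y 0 = 0)
    (h : VanishesAt Z k f (e.symm x)) : VanishesAt Z k f (e.symm y) := by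
  have hjets := h.eventually_iterate_dirDeriv_eq_zero he (hball hx)
  obtain ⟨δ, hδ, hδr⟩ := Metric.isOpen_iff.1 isOpen_ball y hy
  refine vanishesAt_of_iterate_dirDeriv_eq_zero he hδ hy0 (hδr.trans hball) (hf.mono hδr) ?_
  exact fun a ha z hz hz0 => eq_zero_on_slice_of_eventually isOpen_ball (convex_ball q r)
    (differentiableOn_iterate_dirDeriv isOpen_ball hf a) (L := slice n) ⟨hx, hx0⟩ ⟨hδr hz, hz0⟩
    (hjets.mono fun w hw hw0 => hw hw0 a ha)

theorem vanishesToOrder {charts : Set (OpenPartialHomeomorph (Fin (n + 1) → ℂ)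
    (Fin (n + 1) → ℂ))} (hcharts : ∀ e ∈ charts, IsAdaptedChart Ω Z e)
    (hcover : ∀ p ∈ Z, ∃ e ∈ charts, p ∈ e.source) (hZ : IsPreconnected Z)
    (hf : DifferentiableOn ℂ f Ω) {p : Fin (n + 1) → ℂ} (hp : p ∈ Z)
    (h : VanishesAt Z k f p) : VanishesToOrder Z k f := by
  have hloc : IsLocallyConstant fun p : Z => VanishesAt Z k f p := by
    rw [IsLocallyConstant.iff_eventually_eq]
    rintro ⟨p, hp⟩
    obtain ⟨e, hec, hpe⟩ := hcover p hp
    have he := hcharts e hec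
    obtain ⟨r, hr, hball⟩ := Metric.isOpen_iff.1 e.open_target (e p) (e.map_source hpe)
    have hfe : DifferentiableOn ℂ (fun x => f (e.symm x)) (ball (e p) r) :=
      hf.comp (he.differentiableOn_symm.mono hball) fun x hx => he.symm_mem (hball hx)
    have hN : IsOpen (e.source ∩ e ⁻¹' ball (e p) r) := e.isOpen_inter_preimage isOpen_ball
    have htransfer : ∀ p₁ ∈ (e.source ∩ e ⁻¹' ball (e p) r) ∩ Z,
        ∀ p₂ ∈ (e.source ∩ e ⁻¹' ball (e p) r) ∩ Z, VanishesAt Z k f p₁ → VanishesAt Z k f p₂ := by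
      rintro p₁ ⟨hp₁, hp₁Z⟩ p₂ ⟨hp₂, hp₂Z⟩ h₁
      rw [← e.left_inv hp₁.1] at h₁
      rw [← e.left_inv hp₂.1]
      exact h₁.of_mem_ball he hball hfe hp₁.2 hp₂.2 ((he.mem_iff _ hp₁.1).1 hp₁Z)
        ((he.mem_iff _ hp₂.1).1 hp₂Z)
    have hpN : p ∈ e.source ∩ e ⁻¹' ball (e p) r := ⟨hpe, mem_ball_self hr⟩
    filter_upwards [(hN.preimage continuous_subtype_val).mem_nhds hpN] with p' hp'
    exact propext ⟨htransfer _ ⟨hp', p'.2⟩ _ ⟨hpN, hp⟩, htransfer _ ⟨hpN, hp⟩ _ ⟨hp', p'.2⟩⟩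
  have : PreconnectedSpace Z := isPreconnected_iff_preconnectedSpace.1 hZ
  exact fun p' hp' => (hloc.apply_eq_of_preconnectedSpace ⟨p, hp⟩ ⟨p', hp'⟩).mp h

end VanishesAt

end Vanishing

section Jets

variable {n k a : ℕ} {Ω Z U : Set (Fin (n + 1) → ℂ)}
  {e : OpenPartialHomeomorph (Fin (n + 1) → ℂ) (Fin (n + 1) → ℂ)}
  {H : Type*} [NormedAddCommGroup H] [InnerProductSpace ℂ H] [CompleteSpace H]
  {M : QuasiFreeModule Ω H} {S : (Fin (n + 1) → ℂ) → H} {q y : Fin (n + 1) → ℂ}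
  {charts : Set (OpenPartialHomeomorph (Fin (n + 1) → ℂ) (Fin (n + 1) → ℂ))}

namespace QuasiFreeModule.IsLocalFrame

theorem iterate_dirDeriv_star_toFun {ψ : (Fin (n + 1) → ℂ) → Fin (n + 1) → ℂ}
    (hS : M.IsLocalFrame ψ U S) (hy : star y ∈ U) (h : H) (a : ℕ) :
    (dirDeriv e₀)^[a] (fun y => star (M.toFun h (ψ (star y)))) y =
      star ((dirDeriv e₀)^[a] (fun x => M.toFun h (ψ x)) (star y)) := by
  have hconj := iterate_dirDeriv_semilinear_comp_star hS.isOpen (hS.differentiableOn_toFun h)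
    (starL ℂ : ℂ ≃L⋆[ℂ] ℂ).toContinuousLinearMap e₀ a hy
  rwa [star_e₀] at hconj

variable (hS : M.IsLocalFrame e.symm U S) (he : IsAdaptedChart Ω Z e) (hUe : U ⊆ e.target)
include hS he hUe

theorem inner_iterate_dirDeriv_eq_zero_of_mem_vanishing (ha : a < k) (hy : star y ∈ U)
    (hy0 : y 0 = 0) {h : H} (hh : h ∈ M.vanishing Z k) : ⟪h, (dirDeriv e₀)^[a] S y⟫_ℂ = 0 := by
  have hy0' : star y 0 = 0 := by simp [hy0]
  have hv : VanishesAt Z k (M.toFun h) (e.symm (star y)) :=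
    hh _ ((he.symm_mem_iff (hUe hy)).2 hy0')
  have hjets := (hv.eventually_iterate_dirDeriv_eq_zero he (hUe hy)).self_of_nhds hy0'
  rw [hS.inner_iterate_dirDeriv hy, iterate_dirDeriv_congr hS.isOpen_preimage_star
    (fun y hy => hS.inner_eq hy h) a hy]
  refine iterate_dirDeriv_smul_eq_zero hS.isOpen_preimage_star (hS.differentiableOn_inner _)
    (hS.differentiableOn_star_toFun h) hy fun b hb => ?_
  rw [hS.iterate_dirDeriv_star_toFun hy, hjets b (by lia), star_zero]

theorem iterate_dirDeriv_mem_quotient (ha : a < k) (hy : star y ∈ U) (hy0 : y 0 = 0) :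
    (dirDeriv e₀)^[a] S y ∈ M.quotient Z k :=
  (Submodule.mem_orthogonal _ _).2 fun _ =>
    hS.inner_iterate_dirDeriv_eq_zero_of_mem_vanishing he hUe ha hy hy0

theorem inner_quotientAct_iterate_dirDeriv (ha : a < k) (hy : star y ∈ U) (hy0 : y 0 = 0)
    (f : funAlg Ω) (h : M.quotient Z k) :
    ⟪(M.quotientAct Z k f h : H), (dirDeriv e₀)^[a] S y⟫_ℂ =
      ⟪(h : H), (dirDeriv e₀)^[a]
        (fun y => star (M.toFun (M.incl f) (e.symm (star y))) • S y) y⟫_ℂ := by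
  rw [← hS.inner_act_iterate_dirDeriv hy]
  exact Submodule.inner_orthogonalProjectionOnto_eq_of_mem_right
    ⟨_, hS.iterate_dirDeriv_mem_quotient he hUe ha hy hy0⟩ _

theorem mem_vanishing_of_inner_iterate_dirDeriv_eq_zero (hq : q ∈ U) (hq0 : q 0 = 0)
    (hcharts : ∀ e ∈ charts, IsAdaptedChart Ω Z e)
    (hcover : ∀ p ∈ Z, ∃ e ∈ charts, p ∈ e.source) (hZ : IsPreconnected Z) {h : H}
    (hMh : DifferentiableOn ℂ (M.toFun h) Ω)
    (hh : ∀ a < k, ∀ y, star y ∈ U → y 0 = 0 → ⟪h, (dirDeriv e₀)^[a] S y⟫_ℂ = 0) :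
    h ∈ M.vanishing Z k := by
  obtain ⟨r, hr, hrU⟩ := Metric.isOpen_iff.1 hS.isOpen q hq
  refine VanishesAt.vanishesToOrder hcharts hcover hZ hMh ((he.symm_mem_iff (hUe hq)).2 hq0)
    (vanishesAt_of_iterate_dirDeriv_eq_zero he hr hq0 (hrU.trans hUe)
      ((hS.differentiableOn_toFun h).mono hrU) fun a ha x hx hx0 => ?_)
  have hxU : star (star x) ∈ U := by simpa only [star_star] using hrU hx
  have hconj := hS.iterate_dirDeriv_star_toFun hxU h a
  rw [star_star] at hconj
  rw [← star_eq_zero, ← hconj, iterate_dirDeriv_congr hS.isOpen_preimage_star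
    (fun y hy => hS.star_toFun_eq hy h) a hxU]
  refine iterate_dirDeriv_smul_eq_zero hS.isOpen_preimage_star hS.differentiableOn_inv_inner_one
    (hS.differentiableOn_inner h) hxU fun b hb => ?_
  rw [← hS.inner_iterate_dirDeriv hxU]
  exact hh b (by lia) _ hxU (by simp [hx0])

/- The jets along `Z ∩ U` of the frame are total in the quotient module: an element orthogonal to
them vanishes to order `k` near one point of `Z`, hence everywhere, since `Z` is connected. -/
theorem eq_zero_of_inner_iterate_dirDeriv_eq_zero (hq : q ∈ U) (hq0 : q 0 = 0)
    (hcharts : ∀ e ∈ charts, IsAdaptedChart Ω Z e)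
    (hcover : ∀ p ∈ Z, ∃ e ∈ charts, p ∈ e.source) (hZ : IsPreconnected Z)
    {x : M.quotient Z k} (hMx : DifferentiableOn ℂ (M.toFun x) Ω)
    (hx : ∀ a < k, ∀ y, star y ∈ U → y 0 = 0 → ⟪(x : H), (dirDeriv e₀)^[a] S y⟫_ℂ = 0) :
    x = 0 := by
  have hmem : (x : H) ∈ M.vanishing Z k :=
    hS.mem_vanishing_of_inner_iterate_dirDeriv_eq_zero he hUe hq hq0 hcharts hcover hZ hMx hx
  exact Subtype.ext (inner_self_eq_zero.1 ((Submodule.mem_orthogonal _ _).1 x.2 _ hmem))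

end QuasiFreeModule.IsLocalFrame

end Jets

section Gram

variable {ι K K' : Type*} [NormedAddCommGroup K] [InnerProductSpace ℂ K]
  [NormedAddCommGroup K'] [InnerProductSpace ℂ K']

theorem inner_linearCombination (v : ι → K) (c d : ι →₀ ℂ) :
    ⟪Finsupp.linearCombination ℂ v c, Finsupp.linearCombination ℂ v d⟫_ℂ =
      d.sum fun j b => c.sum fun i a => b * ((starRingEnd ℂ) a * ⟪v i, v j⟫_ℂ) := by
  simp only [Finsupp.linearCombination_apply, Finsupp.sum_inner, Finsupp.inner_sum,
    inner_smul_left, inner_smul_right, Finsupp.mul_sum]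

theorem norm_linearCombination_eq_of_inner_eq {v : ι → K} {v' : ι → K'}
    (hgram : ∀ i j, ⟪v i, v j⟫_ℂ = ⟪v' i, v' j⟫_ℂ) (c : ι →₀ ℂ) :
    ‖Finsupp.linearCombination ℂ v c‖ = ‖Finsupp.linearCombination ℂ v' c‖ := by
  simp only [norm_eq_sqrt_re_inner (𝕜 := ℂ), inner_linearCombination, hgram]

theorem denseRange_linearCombination [CompleteSpace K] {v : ι → K}
    (hv : ∀ x : K, (∀ i, ⟪x, v i⟫_ℂ = 0) → x = 0) :
    DenseRange (Finsupp.linearCombination ℂ v) := by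
  have h : (Submodule.span ℂ (range v)).topologicalClosure = ⊤ := by
    rw [Submodule.topologicalClosure_eq_top_iff, Submodule.eq_bot_iff]
    exact fun x hx => hv x fun i =>
      (Submodule.mem_orthogonal' _ _).1 hx _ (Submodule.subset_span ⟨i, rfl⟩)
  rw [← Finsupp.range_linearCombination] at h
  exact Submodule.dense_iff_topologicalClosure_eq_top.2 h

theorem exists_linearIsometryEquiv_of_denseRange [CompleteSpace K] [CompleteSpace K']
    {F : Type*} [AddCommGroup F] [Module ℂ F] {L : F →ₗ[ℂ] K} {L' : F →ₗ[ℂ] K'}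
    (hd : DenseRange L) (hd' : DenseRange L') (hnorm : ∀ c, ‖L c‖ = ‖L' c‖) :
    ∃ V : K ≃ₗᵢ[ℂ] K', ∀ c, V (L c) = L' c := by
  have hL' : ∀ c, ‖L' c‖ ≤ 1 * ‖L c‖ := fun c => by rw [one_mul, hnorm]
  have hL : ∀ c, ‖L c‖ ≤ 1 * ‖L' c‖ := fun c => by rw [one_mul, hnorm]
  let T := L'.extendOfNorm L
  let T' := L.extendOfNorm L'
  have hT : ∀ c, T (L c) = L' c := fun c => LinearMap.extendOfNorm_eq hd ⟨1, hL'⟩ c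
  have hT' : ∀ c, T' (L' c) = L c := fun c => LinearMap.extendOfNorm_eq hd' ⟨1, hL⟩ c
  have hT'T : ∀ x, T' (T x) = x := congrFun (hd.equalizer (g := fun x => T' (T x)) (h := id)
    (by fun_prop) continuous_id (by funext c; simp [hT, hT']))
  have hTT' : ∀ x, T (T' x) = x := congrFun (hd'.equalizer (g := fun x => T (T' x)) (h := id)
    (by fun_prop) continuous_id (by funext c; simp [hT, hT']))
  have hTle : ∀ x, ‖T x‖ ≤ ‖x‖ := fun x => by
    simpa using LinearMap.norm_extendOfNorm_apply_le hd 1 hL' x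
  have hT'le : ∀ x, ‖T' x‖ ≤ ‖x‖ := fun x => by
    simpa using LinearMap.norm_extendOfNorm_apply_le hd' 1 hL x
  refine ⟨⟨LinearEquiv.ofLinearMap T.toLinearMap T'.toLinearMap (LinearMap.ext hTT')
    (LinearMap.ext hT'T), fun x => le_antisymm (hTle x) ?_⟩, hT⟩
  simpa only [hT'T] using! hT'le (T x)

theorem exists_linearIsometryEquiv_of_inner_eq [CompleteSpace K] [CompleteSpace K']
    {v : ι → K} {v' : ι → K'} (hv : ∀ x : K, (∀ i, ⟪x, v i⟫_ℂ = 0) → x = 0)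
    (hv' : ∀ x : K', (∀ i, ⟪x, v' i⟫_ℂ = 0) → x = 0)
    (hgram : ∀ i j, ⟪v i, v j⟫_ℂ = ⟪v' i, v' j⟫_ℂ) :
    ∃ V : K ≃ₗᵢ[ℂ] K', ∀ i, V (v i) = v' i := by
  obtain ⟨V, hV⟩ := exists_linearIsometryEquiv_of_denseRange (denseRange_linearCombination hv)
    (denseRange_linearCombination hv') (norm_linearCombination_eq_of_inner_eq hgram)
  exact ⟨V, fun i => by simpa using hV (Finsupp.single i 1)⟩

end Gram

section Quotient

variable {n k : ℕ} {Ω Z U : Set (Fin (n + 1) → ℂ)}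
  {e : OpenPartialHomeomorph (Fin (n + 1) → ℂ) (Fin (n + 1) → ℂ)}
  {H H' : Type*} [NormedAddCommGroup H] [InnerProductSpace ℂ H] [CompleteSpace H]
  [NormedAddCommGroup H'] [InnerProductSpace ℂ H'] [CompleteSpace H']
  {M : QuasiFreeModule Ω H} {M' : QuasiFreeModule Ω H'}
  {S s : (Fin (n + 1) → ℂ) → H} {S' s' : (Fin (n + 1) → ℂ) → H'}

theorem toFun_incl_eq (M : QuasiFreeModule Ω H) (M' : QuasiFreeModule Ω H') (f : funAlg Ω) :
    M.toFun (M.incl f) = M'.toFun (M'.incl f) := by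
  funext w
  by_cases hw : w ∈ Ω
  · rw [QuasiFreeModule.toFun_of_mem _ _ hw, QuasiFreeModule.toFun_of_mem _ _ hw,
      QuasiFreeModule.eval_incl, QuasiFreeModule.eval_incl]
  · simp [QuasiFreeModule.toFun, hw]

theorem QuasiFreeModule.IsFrame.quotientAct_projection (hs : M.IsFrame s) (hΩ : IsOpen Ω)
    (hZ : Z ⊆ Ω) (f : funAlg Ω) (u : H) :
    M.quotientAct Z k f ((M.quotient Z k).orthogonalProjectionOnto u) =
      (M.quotient Z k).orthogonalProjectionOnto (M.act f u) := by
  rw [quotientAct, ← sub_eq_zero, ← map_sub, ← map_sub,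
    Submodule.orthogonalProjectionOnto_eq_zero_iff, ← neg_sub]
  exact hs.act_mem_orthogonal_quotient hΩ hZ f
    (Submodule.neg_mem _ (Submodule.sub_starProjection_mem_orthogonal u))

/-- The jets up to order `k - 1` along `{z₁ = 0}`, in the direction `∂₁`, of the vector-valued
functions `S` and `S'` of the conjugate coordinates have the same Gram matrices. -/
def SameJetGram (k : ℕ) (U : Set (Fin (n + 1) → ℂ)) (S : (Fin (n + 1) → ℂ) → H)
    (S' : (Fin (n + 1) → ℂ) → H') : Prop :=
  ∀ a < k, ∀ b < k, ∀ y, star y ∈ U → ∀ y', star y' ∈ U → y 0 = 0 → y' 0 = 0 →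
    ⟪(dirDeriv e₀)^[a] S y, (dirDeriv e₀)^[b] S y'⟫_ℂ =
      ⟪(dirDeriv e₀)^[a] S' y, (dirDeriv e₀)^[b] S' y'⟫_ℂ

section Isomorphic

variable {V : M.quotient Z k ≃ₗᵢ[ℂ] M'.quotient Z k}

theorem inner_incl_eq_inner_act_of_intertwining (hs' : M'.IsFrame s') (hΩ : IsOpen Ω)
    (hZ : Z ⊆ Ω) (hV : ∀ f h, V (M.quotientAct Z k f h) = M'.quotientAct Z k f (V h))
    {g : M.quotient Z k} (hg : V g = (M'.quotient Z k).orthogonalProjectionOnto M'.one)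
    (f : funAlg Ω) (x : M.quotient Z k) : ⟪M'.incl f, (V x : H')⟫_ℂ = ⟪M.act f g, (x : H)⟫_ℂ := by
  have hproj : (M'.quotient Z k).orthogonalProjectionOnto (M'.incl f) =
      V (M.quotientAct Z k f g) := by
    rw [hV, hg, hs'.quotientAct_projection hΩ hZ, M'.act_one]
  calc ⟪M'.incl f, (V x : H')⟫_ℂ
      = ⟪(M'.quotient Z k).orthogonalProjectionOnto (M'.incl f), V x⟫_ℂ :=
        (Submodule.inner_orthogonalProjectionOnto_eq_of_mem_right _ _).symm
    _ = ⟪M.quotientAct Z k f g, x⟫_ℂ := by rw [hproj, V.inner_map_map]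
    _ = ⟪M.act f g, (x : H)⟫_ℂ := Submodule.inner_orthogonalProjectionOnto_eq_of_mem_right _ _

variable {ψ : (Fin (n + 1) → ℂ) → Fin (n + 1) → ℂ}

theorem inner_incl_multiplier_smul (hS : M.IsLocalFrame ψ U S) (hS' : M'.IsLocalFrame ψ U S')
    (g : H) (f : funAlg Ω) {y : Fin (n + 1) → ℂ} (hy : star y ∈ U) :
    ⟪M'.incl f, ((⟪M'.one, S' y⟫_ℂ)⁻¹ * ⟪g, S y⟫_ℂ) • S' y⟫_ℂ = ⟪M.act f g, S y⟫_ℂ := by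
  have h0 := hS'.inner_one_ne_zero hy
  rw [inner_smul_right, ← M'.act_one, hS'.inner_act hy, hS.inner_act hy, toFun_incl_eq M M']
  field_simp

theorem inner_incl_iterate_dirDeriv_multiplier_smul (hS : M.IsLocalFrame ψ U S)
    (hS' : M'.IsLocalFrame ψ U S') (g : H) (f : funAlg Ω) {y : Fin (n + 1) → ℂ}
    (hy : star y ∈ U) (v : Fin (n + 1) → ℂ) (a : ℕ) :
    ⟪M'.incl f, (dirDeriv v)^[a]
        (fun y => ((⟪M'.one, S' y⟫_ℂ)⁻¹ * ⟪g, S y⟫_ℂ) • S' y) y⟫_ℂ =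
      ⟪M.act f g, (dirDeriv v)^[a] S y⟫_ℂ := by
  rw [hS.inner_iterate_dirDeriv hy, ← iterate_dirDeriv_congr hS.isOpen_preimage_star
    (fun y hy => inner_incl_multiplier_smul hS hS' g f hy) a hy]
  exact (iterate_dirDeriv_clm hS.isOpen_preimage_star
    ((hS'.differentiableOn_inv_inner_one.fun_mul (hS.differentiableOn_inner g)).fun_smul
      hS'.differentiableOn) (innerSL ℂ (M'.incl f)) a hy).symm

/- If `V` intertwines the quotient modules and `g` corresponds to the class of `1`, then `V` sends
the jets of `S` to those of `χ S'`, where `χ = ⟪g, S⟫ / ⟪1, S'⟫`. -/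
theorem exists_sameJetGram_smul (hiso : QuotientsIsomorphic M M' Z k) (hs' : M'.IsFrame s')
    (hΩ : IsOpen Ω) (hZ : Z ⊆ Ω) (he : IsAdaptedChart Ω Z e) (hUe : U ⊆ e.target)
    (hS : M.IsLocalFrame e.symm U S) (hS' : M'.IsLocalFrame e.symm U S') :
    ∃ χ : (Fin (n + 1) → ℂ) → ℂ, DifferentiableOn ℂ χ (star ⁻¹' U) ∧
      SameJetGram k U S fun y => χ y • S' y := by
  obtain ⟨V, hV⟩ := hiso
  obtain ⟨g, hg⟩ := V.surjective ((M'.quotient Z k).orthogonalProjectionOnto M'.one)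
  have hjet : ∀ a (ha : a < k) y (hy : star y ∈ U) (hy0 : y 0 = 0),
      (V ⟨_, hS.iterate_dirDeriv_mem_quotient he hUe ha hy hy0⟩ : H') =
        (dirDeriv e₀)^[a] (fun y => ((⟪M'.one, S' y⟫_ℂ)⁻¹ * ⟪(g : H), S y⟫_ℂ) • S' y) y :=
    fun a ha y hy hy0 => M'.denseRange_incl.eq_of_inner_right ℂ fun f => by
      rw [inner_incl_eq_inner_act_of_intertwining hs' hΩ hZ hV hg,
        inner_incl_iterate_dirDeriv_multiplier_smul hS hS' _ _ hy]
  refine ⟨_, hS'.differentiableOn_inv_inner_one.fun_mul (hS.differentiableOn_inner g),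
    fun a ha b hb y hy y' hy' hy0 hy0' => ?_⟩
  rw [← hjet a ha y hy hy0, ← hjet b hb y' hy' hy0', ← Submodule.coe_inner, V.inner_map_map]
  rfl

end Isomorphic

theorem SameJetGram.exists_linearIsometryEquiv (hgram : SameJetGram k U S S')
    (hs : M.IsFrame s) (hs' : M'.IsFrame s') (hΩ : IsOpen Ω)
    {charts : Set (OpenPartialHomeomorph (Fin (n + 1) → ℂ) (Fin (n + 1) → ℂ))}
    (hcharts : ∀ e ∈ charts, IsAdaptedChart Ω Z e)
    (hcover : ∀ p ∈ Z, ∃ e ∈ charts, p ∈ e.source) (hZ : IsPreconnected Z)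
    (he : IsAdaptedChart Ω Z e) (hUe : U ⊆ e.target) {q : Fin (n + 1) → ℂ} (hq : q ∈ U)
    (hq0 : q 0 = 0) (hS : M.IsLocalFrame e.symm U S) (hS' : M'.IsLocalFrame e.symm U S') :
    ∃ V : M.quotient Z k ≃ₗᵢ[ℂ] M'.quotient Z k, ∀ a < k, ∀ y, star y ∈ U → y 0 = 0 →
      (V ((M.quotient Z k).orthogonalProjectionOnto ((dirDeriv e₀)^[a] S y)) : H') =
        (dirDeriv e₀)^[a] S' y := by
  let ι := {p : ℕ × (Fin (n + 1) → ℂ) // p.1 < k ∧ star p.2 ∈ U ∧ p.2 0 = 0}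
  let v : ι → M.quotient Z k := fun p =>
    ⟨_, hS.iterate_dirDeriv_mem_quotient he hUe p.2.1 p.2.2.1 p.2.2.2⟩
  let v' : ι → M'.quotient Z k := fun p =>
    ⟨_, hS'.iterate_dirDeriv_mem_quotient he hUe p.2.1 p.2.2.1 p.2.2.2⟩
  have hv : ∀ x, (∀ i, ⟪x, v i⟫_ℂ = 0) → x = 0 := fun x hx =>
    hS.eq_zero_of_inner_iterate_dirDeriv_eq_zero he hUe hq hq0 hcharts hcover hZ
      (hs.differentiableOn_toFun hΩ x) fun a ha y hy hy0 => hx ⟨(a, y), ha, hy, hy0⟩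
  have hv' : ∀ x, (∀ i, ⟪x, v' i⟫_ℂ = 0) → x = 0 := fun x hx =>
    hS'.eq_zero_of_inner_iterate_dirDeriv_eq_zero he hUe hq hq0 hcharts hcover hZ
      (hs'.differentiableOn_toFun hΩ x) fun a ha y hy hy0 => hx ⟨(a, y), ha, hy, hy0⟩
  obtain ⟨V, hV⟩ := exists_linearIsometryEquiv_of_inner_eq hv hv' fun i j =>
    hgram _ i.2.1 _ j.2.1 _ i.2.2.1 _ j.2.2.1 i.2.2.2 j.2.2.2
  refine ⟨V, fun a ha y hy hy0 => ?_⟩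
  have hproj := Submodule.orthogonalProjectionOnto_mem_subspace_eq_self
    (v ⟨(a, y), ha, hy, hy0⟩)
  exact congrArg Subtype.val ((congrArg V hproj).trans (hV ⟨(a, y), ha, hy, hy0⟩))

theorem SameJetGram.quotientsIsomorphic (hgram : SameJetGram k U S S')
    (hs : M.IsFrame s) (hs' : M'.IsFrame s') (hΩ : IsOpen Ω)
    {charts : Set (OpenPartialHomeomorph (Fin (n + 1) → ℂ) (Fin (n + 1) → ℂ))}
    (hcharts : ∀ e ∈ charts, IsAdaptedChart Ω Z e)
    (hcover : ∀ p ∈ Z, ∃ e ∈ charts, p ∈ e.source) (hZ : IsPreconnected Z)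
    (he : IsAdaptedChart Ω Z e) (hUe : U ⊆ e.target) {q : Fin (n + 1) → ℂ} (hq : q ∈ U)
    (hq0 : q 0 = 0) (hS : M.IsLocalFrame e.symm U S) (hS' : M'.IsLocalFrame e.symm U S') :
    QuotientsIsomorphic M M' Z k := by
  obtain ⟨V, hV⟩ :=
    hgram.exists_linearIsometryEquiv hs hs' hΩ hcharts hcover hZ he hUe hq hq0 hS hS'
  let P : H →L[ℂ] M.quotient Z k := (M.quotient Z k).orthogonalProjectionOnto
  let L : H →L[ℂ] H' :=
    (M'.quotient Z k).subtypeL ∘L V.toContinuousLinearEquiv.toContinuousLinearMap ∘L P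
  have hL : ∀ (h : M.quotient Z k) u, ⟪(V h : H'), L u⟫_ℂ = ⟪(h : H), u⟫_ℂ := fun h u =>
    (V.inner_map_map h (P u)).trans (Submodule.inner_orthogonalProjectionOnto_eq_of_mem_left h u)
  refine ⟨V, fun f h => sub_eq_zero.1 <|
    hS'.eq_zero_of_inner_iterate_dirDeriv_eq_zero he hUe hq hq0 hcharts hcover hZ
      (hs'.differentiableOn_toFun hΩ _) fun a ha y hy hy0 => ?_⟩
  have hjet : ∀ b ≤ a, L ((dirDeriv e₀)^[b] S y) = (dirDeriv e₀)^[b] S' y := fun b hb =>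
    hV b (by lia) y hy hy0
  have hmulJet := clm_iterate_dirDeriv_smul hS.isOpen_preimage_star
    (hS.differentiableOn_star_toFun (M.incl f)) hS.differentiableOn hS'.differentiableOn L hy hjet
  rw [Submodule.coe_sub, inner_sub_left, sub_eq_zero,
    hS'.inner_quotientAct_iterate_dirDeriv he hUe ha hy hy0, ← toFun_incl_eq M M', ← hmulJet, hL,
    ← hjet a le_rfl, hL, hS.inner_quotientAct_iterate_dirDeriv he hUe ha hy hy0]

end Quotient

section MixedDeriv

variable {m : ℕ} {U : Set (Fin m → ℂ)} {f g : (Fin m → ℂ) × (Fin m → ℂ) → ℂ}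
  {A : (Fin m → ℂ) → ℂ}

/-- The mixed derivative `∂_{y_i}^b ∂_{x_j}^a` of a function of `(x, y)`; on polarizations it
corresponds to the operator `∂̄_i^b ∂_j^a`. -/
def mixedDeriv (i : Fin m) (b : ℕ) (j : Fin m) (a : ℕ) (f : (Fin m → ℂ) × (Fin m → ℂ) → ℂ) :
    (Fin m → ℂ) × (Fin m → ℂ) → ℂ :=
  (dirDeriv (0, Pi.single i 1))^[b] ((dirDeriv (Pi.single j 1, 0))^[a] f)

theorem differentiableOn_mixedDeriv (hU : IsOpen U) (hf : DifferentiableOn ℂ f (conjSquare U))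
    (i : Fin m) (b : ℕ) (j : Fin m) (a : ℕ) :
    DifferentiableOn ℂ (mixedDeriv i b j a f) (conjSquare U) :=
  differentiableOn_iterate_dirDeriv (isOpen_conjSquare hU)
    (differentiableOn_iterate_dirDeriv (isOpen_conjSquare hU) hf a) b

theorem mixedDeriv_congr (hU : IsOpen U) (h : EqOn f g (conjSquare U)) (i : Fin m) (b : ℕ)
    (j : Fin m) (a : ℕ) : EqOn (mixedDeriv i b j a f) (mixedDeriv i b j a g) (conjSquare U) :=
  iterate_dirDeriv_congr (isOpen_conjSquare hU)
    (iterate_dirDeriv_congr (isOpen_conjSquare hU) h a) b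

theorem mixedDeriv_add (hU : IsOpen U) (hf : DifferentiableOn ℂ f (conjSquare U))
    (hg : DifferentiableOn ℂ g (conjSquare U)) (i : Fin m) (b : ℕ) (j : Fin m) (a : ℕ) :
    EqOn (mixedDeriv i b j a fun p => f p + g p)
      (fun p => mixedDeriv i b j a f p + mixedDeriv i b j a g p) (conjSquare U) := by
  have hUU := isOpen_conjSquare hU
  exact (iterate_dirDeriv_congr hUU (iterate_dirDeriv_add hUU hf hg a) b).trans
    (iterate_dirDeriv_add hUU (differentiableOn_iterate_dirDeriv hUU hf a)
      (differentiableOn_iterate_dirDeriv hUU hg a) b)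

theorem mixedDeriv_sub (hU : IsOpen U) (hf : DifferentiableOn ℂ f (conjSquare U))
    (hg : DifferentiableOn ℂ g (conjSquare U)) (i : Fin m) (b : ℕ) (j : Fin m) (a : ℕ) :
    EqOn (mixedDeriv i b j a fun p => f p - g p)
      (fun p => mixedDeriv i b j a f p - mixedDeriv i b j a g p) (conjSquare U) := by
  have hUU := isOpen_conjSquare hU
  exact (iterate_dirDeriv_congr hUU (iterate_dirDeriv_sub hUU hf hg a) b).trans
    (iterate_dirDeriv_sub hUU (differentiableOn_iterate_dirDeriv hUU hf a)
      (differentiableOn_iterate_dirDeriv hUU hg a) b)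

theorem mixedDeriv_comp_snd (hU : IsOpen U) (hA : DifferentiableOn ℂ A (star ⁻¹' U)) (i : Fin m)
    (b : ℕ) (j : Fin m) {a : ℕ} (ha : a ≠ 0) :
    EqOn (mixedDeriv i b j a fun p => A p.2) (fun _ => 0) (conjSquare U) := by
  have hUU := isOpen_conjSquare hU
  have hzero : EqOn (dirDeriv (Pi.single j 1, 0) fun p : (Fin m → ℂ) × (Fin m → ℂ) => A p.2)
      (fun _ => 0) (conjSquare U) := fun p hp => by
    have hAp := hA.differentiableAt ((hU.preimage continuous_star).mem_nhds hp.2)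
    exact (congrArg (· (Pi.single j 1, 0)) (hAp.hasFDerivAt.comp p hasFDerivAt_snd).fderiv).trans
      (map_zero (fderiv ℂ A p.2))
  obtain ⟨a, rfl⟩ := Nat.exists_eq_succ_of_ne_zero ha
  have hiter := iterate_dirDeriv_congr (v := (0, Pi.single i 1)) hUU
    (iterate_dirDeriv_congr (v := (Pi.single j 1, 0)) hUU hzero a) b
  rwa [iterate_dirDeriv_zero, iterate_dirDeriv_zero] at hiter

theorem mixedDeriv_comp_fst (hU : IsOpen U) (hA : DifferentiableOn ℂ A U) (i : Fin m) {b : ℕ}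
    (hb : b ≠ 0) (j : Fin m) (a : ℕ) :
    EqOn (mixedDeriv i b j a fun p => A p.1) (fun _ => 0) (conjSquare U) := by
  have hUU := isOpen_conjSquare hU
  have hA' : DifferentiableOn ℂ (fun p : (Fin m → ℂ) × (Fin m → ℂ) => A p.1) (conjSquare U) :=
    hA.comp differentiableOn_fst fun _ hp => hp.1
  have hzero : EqOn (dirDeriv (0, Pi.single i 1) fun p : (Fin m → ℂ) × (Fin m → ℂ) => A p.1)
      (fun _ => 0) (conjSquare U) := fun p hp => by
    have hAp := hA.differentiableAt (hU.mem_nhds hp.1)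
    exact (congrArg (· (0, Pi.single i 1)) (hAp.hasFDerivAt.comp p hasFDerivAt_fst).fderiv).trans
      (map_zero (fderiv ℂ A p.1))
  obtain ⟨b, rfl⟩ := Nat.exists_eq_succ_of_ne_zero hb
  have hcomm := (dirDeriv_iterate_comm (v := (Pi.single j 1, 0)) (w := (0, Pi.single i 1))
    hUU hA' a).trans (iterate_dirDeriv_congr hUU hzero a)
  have hiter := iterate_dirDeriv_congr (v := (0, Pi.single i 1)) hUU hcomm b
  rwa [iterate_dirDeriv_zero, iterate_dirDeriv_zero] at hiter

theorem mixedDeriv_add_separated {B : (Fin m → ℂ) → ℂ} (hU : IsOpen U)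
    (hf : DifferentiableOn ℂ f (conjSquare U)) (hA : DifferentiableOn ℂ A U)
    (hB : DifferentiableOn ℂ B (star ⁻¹' U)) (i : Fin m) {b : ℕ} (hb : b ≠ 0) (j : Fin m) {a : ℕ}
    (ha : a ≠ 0) :
    EqOn (mixedDeriv i b j a fun p => f p + (A p.1 + B p.2)) (mixedDeriv i b j a f)
      (conjSquare U) := fun p hp => by
  have hA' : DifferentiableOn ℂ (fun p : (Fin m → ℂ) × (Fin m → ℂ) => A p.1) (conjSquare U) :=
    hA.comp differentiableOn_fst fun _ hp => hp.1
  have hB' : DifferentiableOn ℂ (fun p : (Fin m → ℂ) × (Fin m → ℂ) => B p.2) (conjSquare U) :=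
    hB.comp differentiableOn_snd fun _ hp => hp.2
  calc _ = mixedDeriv i b j a f p + mixedDeriv i b j a (fun p => A p.1 + B p.2) p :=
        mixedDeriv_add hU hf (hA'.fun_add hB') i b j a hp
    _ = mixedDeriv i b j a f p +
          (mixedDeriv i b j a (fun p => A p.1) p + mixedDeriv i b j a (fun p => B p.2) p) :=
        congrArg _ (mixedDeriv_add hU hA' hB' i b j a hp)
    _ = mixedDeriv i b j a f p := by
        rw [mixedDeriv_comp_fst hU hA i hb j a hp, mixedDeriv_comp_snd hU hB i b j ha hp,
          add_zero, add_zero]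

end MixedDeriv

section JetVanish

variable {n k : ℕ} {U : Set (Fin (n + 1) → ℂ)}
  {f g : (Fin (n + 1) → ℂ) × (Fin (n + 1) → ℂ) → ℂ}

/-- The pairs of points of the slice: the polarization of the hypersurface in an adapted
chart. -/
abbrev sliceSquare (n : ℕ) : Submodule ℂ ((Fin (n + 1) → ℂ) × (Fin (n + 1) → ℂ)) :=
  (slice n).prod (slice n)

theorem slice_eq_span :
    slice n = Submodule.span ℂ (range fun j : Fin n => (Pi.single j.succ 1 : Fin (n + 1) → ℂ)) := by
  refine le_antisymm (fun v hv => ?_) (Submodule.span_le.2 (range_subset_iff.2 fun j => by simp))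
  have hv0 : v 0 = 0 := hv
  rw [pi_eq_sum_univ' v, Fin.sum_univ_succ, hv0, zero_smul, zero_add]
  exact Submodule.sum_mem _ fun j _ =>
    Submodule.smul_mem _ _ (Submodule.subset_span ⟨j, rfl⟩)

theorem single_succ_mem_slice (j : Fin n) : (Pi.single j.succ 1 : Fin (n + 1) → ℂ) ∈ slice n :=
  slice_eq_span.ge (Submodule.subset_span ⟨j, rfl⟩)

/-- The mixed derivatives of `f` of order less than `k` in each of the normal variables `x₁` and
`y₁` vanish on `{x₁ = y₁ = 0}`: near this set, `f` lies in the ideal `(x₁ ^ k, y₁ ^ k)`. -/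
def JetVanish (k : ℕ) (U : Set (Fin (n + 1) → ℂ))
    (f : (Fin (n + 1) → ℂ) × (Fin (n + 1) → ℂ) → ℂ) : Prop :=
  ∀ a < k, ∀ b < k, ∀ p ∈ conjSquare U ∩ sliceSquare n, mixedDeriv 0 b 0 a f p = 0

theorem JetVanish.congr (hU : IsOpen U) (hf : JetVanish k U f) (h : EqOn g f (conjSquare U)) :
    JetVanish k U g := fun a ha b hb p hp =>
  (mixedDeriv_congr hU h 0 b 0 a hp.1).trans (hf a ha b hb p hp)

theorem JetVanish.mono {V : Set (Fin (n + 1) → ℂ)} (hf : JetVanish k U f) (h : V ⊆ U) :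
    JetVanish k V f := fun a ha b hb p hp => hf a ha b hb p ⟨⟨h hp.1.1, h hp.1.2⟩, hp.2⟩

theorem JetVanish.smul (hU : IsOpen U) (h : JetVanish k U f)
    (hf : DifferentiableOn ℂ f (conjSquare U)) (hg : DifferentiableOn ℂ g (conjSquare U)) :
    JetVanish k U fun p => g p • f p := fun _ ha _ hb p hp =>
  iterate_dirDeriv_iterate_smul_eq_zero (isOpen_conjSquare hU) hg hf hp.1
    fun b' hb' a' ha' => h a' (by lia) b' (by lia) p hp

theorem JetVanish.comp (hU : IsOpen U) (h : JetVanish k U f)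
    (hf : DifferentiableOn ℂ f (conjSquare U)) {φ : ℂ → ℂ} {O : Set ℂ} (hO : O ∈ 𝓝 0)
    (hφ : DifferentiableOn ℂ φ O) (hφ0 : φ 0 = 0) (hmaps : MapsTo f (conjSquare U) O) :
    JetVanish k U fun p => φ (f p) := by
  have hslope : ∀ z, φ z = dslope φ 0 z • z := fun z => by
    simpa [hφ0, mul_comm] using (sub_smul_dslope φ 0 z).symm
  have hd : DifferentiableOn ℂ (fun p => dslope φ 0 (f p)) (conjSquare U) :=
    ((Complex.differentiableOn_dslope hO).2 hφ).comp hf hmaps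
  exact (h.smul hU hf hd).congr hU fun p _ => hslope (f p)

theorem dirDeriv_eq_zero_of_mem_sliceSquare (hU : IsOpen U)
    (hf : DifferentiableOn ℂ f (conjSquare U))
    (h : ∀ p ∈ conjSquare U ∩ sliceSquare n, f p = 0)
    {v : (Fin (n + 1) → ℂ) × (Fin (n + 1) → ℂ)} (hv : v ∈ sliceSquare n) :
    ∀ p ∈ conjSquare U ∩ sliceSquare n, dirDeriv v f p = 0 :=
  dirDeriv_eq_zero_of_forall_add_smul_mem (isOpen_conjSquare hU) hf
    (fun _ hz t => (sliceSquare n).add_mem hz ((sliceSquare n).smul_mem t hv)) h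

/-- The coordinate and the order of the operators heading the rows and columns of `𝒟_k`. -/
def opIndex : Fin n ⊕ Fin (k - 1) → Fin (n + 1) × ℕ
  | Sum.inl j => (j.succ, 1)
  | Sum.inr b => (0, b + 1)

theorem opIndex_snd_ne_zero (i : Fin n ⊕ Fin (k - 1)) : (opIndex i).2 ≠ 0 := by
  cases i <;> simp [opIndex]

/-- The entry of the array `𝒟_k` of operators in row `i` and column `j`, acting on
polarizations. -/
def polarEntry (i j : Fin n ⊕ Fin (k - 1)) (f : (Fin (n + 1) → ℂ) × (Fin (n + 1) → ℂ) → ℂ) :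
    (Fin (n + 1) → ℂ) × (Fin (n + 1) → ℂ) → ℂ :=
  mixedDeriv (opIndex i).1 (opIndex i).2 (opIndex j).1 (opIndex j).2 f

theorem diffArray_apply_eq_polarEntry {F : (Fin (n + 1) → ℂ) → ℂ} (hU : IsOpen U)
    (hf : DifferentiableOn ℂ f (conjSquare U)) (h : EqOn F (antidiag f) U)
    {x : Fin (n + 1) → ℂ} (hx : x ∈ U) (i j : Fin n ⊕ Fin (k - 1)) :
    diffArray k F x i j = polarEntry i j f (x, star x) := by
  have hcol : colOp j F = (del (opIndex j).1)^[(opIndex j).2] F := by cases j <;> rfl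
  have hrow : ∀ G, rowOp i G = (delBar (opIndex i).1)^[(opIndex i).2] G := fun G => by
    cases i <;> rfl
  rw [diffArray, Matrix.of_apply, hcol, hrow]
  exact iterate_delBar_antidiag hU
    (differentiableOn_iterate_dirDeriv (isOpen_conjSquare hU) hf _)
    (iterate_del_antidiag hU hf h _ _) _ _ hx

theorem polarEntry_add_separated {A B : (Fin (n + 1) → ℂ) → ℂ} (hU : IsOpen U)
    (hf : DifferentiableOn ℂ f (conjSquare U)) (hA : DifferentiableOn ℂ A U)
    (hB : DifferentiableOn ℂ B (star ⁻¹' U)) (i j : Fin n ⊕ Fin (k - 1)) :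
    EqOn (polarEntry i j fun p => f p + (A p.1 + B p.2)) (polarEntry i j f) (conjSquare U) :=
  mixedDeriv_add_separated hU hf hA hB _ (opIndex_snd_ne_zero i) _ (opIndex_snd_ne_zero j)

theorem JetVanish.polarEntry_eq_zero (hU : IsOpen U) (hk : 1 ≤ k) (h : JetVanish k U f)
    (hf : DifferentiableOn ℂ f (conjSquare U)) (i j : Fin n ⊕ Fin (k - 1)) :
    ∀ p ∈ conjSquare U ∩ sliceSquare n, polarEntry i j f p = 0 := by
  have hUU := isOpen_conjSquare hU
  have hfst (j : Fin n) : ((Pi.single j.succ 1, 0) : _ × (Fin (n + 1) → ℂ)) ∈ sliceSquare n :=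
    ⟨single_succ_mem_slice j, zero_mem _⟩
  have hsnd (j : Fin n) : ((0, Pi.single j.succ 1) : (Fin (n + 1) → ℂ) × _) ∈ sliceSquare n :=
    ⟨zero_mem _, single_succ_mem_slice j⟩
  have hd (v : (Fin (n + 1) → ℂ) × (Fin (n + 1) → ℂ)) (a : ℕ) :
      DifferentiableOn ℂ ((dirDeriv v)^[a] f) (conjSquare U) :=
    differentiableOn_iterate_dirDeriv hUU hf a
  rcases i with i | i <;> rcases j with j | j
  · exact dirDeriv_eq_zero_of_mem_sliceSquare hU (hd _ 1)
      (dirDeriv_eq_zero_of_mem_sliceSquare hU hf (h 0 hk 0 hk) (hfst j)) (hsnd i)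
  · exact dirDeriv_eq_zero_of_mem_sliceSquare hU (hd _ (j + 1))
      (h (j + 1) (by lia) 0 hk) (hsnd i)
  · exact fun p hp => (dirDeriv_iterate_comm hUU hf (i + 1) hp.1).symm.trans
      (dirDeriv_eq_zero_of_mem_sliceSquare hU (hd _ (i + 1))
        (h 0 hk (i + 1) (by lia)) (hfst j) p hp)
  · exact h (j + 1) (by lia) (i + 1) (by lia)

theorem eq_of_dirDeriv_eq_zero_of_sub_mem_map_slice (hU : IsOpen U) (hconv : Convex ℝ U)
    (hf : DifferentiableOn ℂ f (conjSquare U))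
    {ι : (Fin (n + 1) → ℂ) →ₗ[ℂ] (Fin (n + 1) → ℂ) × (Fin (n + 1) → ℂ)}
    (hι : (slice n).map ι ≤ sliceSquare n)
    (h : ∀ j : Fin n, ∀ p ∈ conjSquare U ∩ sliceSquare n,
      dirDeriv (ι (Pi.single j.succ 1)) f p = 0)
    {p p' : (Fin (n + 1) → ℂ) × (Fin (n + 1) → ℂ)} (hp : p ∈ conjSquare U ∩ sliceSquare n)
    (hp' : p' ∈ conjSquare U) (hsub : p' - p ∈ (slice n).map ι) : f p' = f p := by
  rw [slice_eq_span, Submodule.map_span] at hsub hι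
  refine eq_of_dirDeriv_eq_zero_of_sub_mem_span (isOpen_conjSquare hU)
    (convex_conjSquare hconv) hf hp.1 hp' hsub fun z hz hzp w hw => ?_
  obtain ⟨_, ⟨j, rfl⟩, rfl⟩ := hw
  exact h j z ⟨hz, by simpa using add_mem (hι hzp) hp.2⟩

theorem eq_of_dirDeriv_snd_eq_zero (hU : IsOpen U) (hconv : Convex ℝ U)
    (hf : DifferentiableOn ℂ f (conjSquare U))
    (h : ∀ j : Fin n, ∀ p ∈ conjSquare U ∩ sliceSquare n,
      dirDeriv (0, Pi.single j.succ 1) f p = 0)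
    {x y y' : Fin (n + 1) → ℂ} (hy : (x, y) ∈ conjSquare U ∩ sliceSquare n)
    (hy' : (x, y') ∈ conjSquare U ∩ sliceSquare n) : f (x, y') = f (x, y) :=
  eq_of_dirDeriv_eq_zero_of_sub_mem_map_slice hU hconv hf (ι := LinearMap.inr ℂ _ _)
    (Submodule.map_le_iff_le_comap.2 fun _ hu => ⟨zero_mem _, hu⟩) h hy hy'.1
    ⟨y' - y, sub_mem hy'.2.2 hy.2.2, by simp⟩

theorem eq_of_dirDeriv_fst_eq_zero (hU : IsOpen U) (hconv : Convex ℝ U)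
    (hf : DifferentiableOn ℂ f (conjSquare U))
    (h : ∀ j : Fin n, ∀ p ∈ conjSquare U ∩ sliceSquare n,
      dirDeriv (Pi.single j.succ 1, 0) f p = 0)
    {x x' y : Fin (n + 1) → ℂ} (hx : (x, y) ∈ conjSquare U ∩ sliceSquare n)
    (hx' : (x', y) ∈ conjSquare U ∩ sliceSquare n) : f (x', y) = f (x, y) :=
  eq_of_dirDeriv_eq_zero_of_sub_mem_map_slice hU hconv hf (ι := LinearMap.inl ℂ _ _)
    (Submodule.map_le_iff_le_comap.2 fun _ hu => ⟨hu, zero_mem _⟩) h hx hx'.1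
    ⟨x' - x, sub_mem hx'.2.1 hx.2.1, by simp⟩

theorem iterate_dirDeriv_fst_eq_zero (hU : IsOpen U) (hf : DifferentiableOn ℂ f (conjSquare U))
    {x y : Fin (n + 1) → ℂ} (h : ∀ x, f (x, y) = 0) (hp : (x, y) ∈ conjSquare U)
    (v : Fin (n + 1) → ℂ) (a : ℕ) : (dirDeriv (v, 0))^[a] f (x, y) = 0 :=
  iterate_dirDeriv_eq_zero_of_forall_add_smul_mem (W := Prod.snd ⁻¹' {y}) (isOpen_conjSquare hU)
    hf (fun z hz t => by simpa using hz)
    (fun z hz => by rw [← h z.1, ← show z.2 = y from hz.2]) a _ ⟨hp, rfl⟩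

theorem iterate_dirDeriv_snd_eq_zero (hU : IsOpen U) (hf : DifferentiableOn ℂ f (conjSquare U))
    {x y : Fin (n + 1) → ℂ} (h : ∀ y, f (x, y) = 0) (hp : (x, y) ∈ conjSquare U)
    (v : Fin (n + 1) → ℂ) (a : ℕ) : (dirDeriv (0, v))^[a] f (x, y) = 0 :=
  iterate_dirDeriv_eq_zero_of_forall_add_smul_mem (W := Prod.fst ⁻¹' {x}) (isOpen_conjSquare hU)
    hf (fun z hz t => by simpa using hz)
    (fun z hz => by rw [← h z.2, ← show z.1 = x from hz.2]) a _ ⟨hp, rfl⟩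

/- `𝒟_k` only sees derivatives of positive order in both `x` and `y`; the normalisation at `q`
supplies those of order zero. -/
theorem jetVanish_of_polarEntry_eq_zero (hU : IsOpen U) (hconv : Convex ℝ U)
    (hf : DifferentiableOn ℂ f (conjSquare U)) {q : Fin (n + 1) → ℂ} (hq : q ∈ U) (hq0 : q 0 = 0)
    (hx : ∀ x, f (x, star q) = 0) (hy : ∀ y, f (q, y) = 0)
    (h : ∀ i j : Fin n ⊕ Fin (k - 1), ∀ p ∈ conjSquare U ∩ sliceSquare n,
      polarEntry i j f p = 0) :
    JetVanish k U f := by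
  have hUU := isOpen_conjSquare hU
  have hqs : star q ∈ slice n := by simp [hq0]
  have hqU : star q ∈ star ⁻¹' U := (mk_star_mem_conjSquare hq).2
  have hd (v : (Fin (n + 1) → ℂ) × (Fin (n + 1) → ℂ)) (a : ℕ) :
      DifferentiableOn ℂ ((dirDeriv v)^[a] f) (conjSquare U) :=
    differentiableOn_iterate_dirDeriv hUU hf a
  rintro a ha b hb ⟨x, y⟩ hp
  have hpq : (q, y) ∈ conjSquare U ∩ sliceSquare n := ⟨⟨hq, hp.1.2⟩, hq0, hp.2.2⟩
  have hpq' (p) (hp : p ∈ conjSquare U ∩ sliceSquare n) :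
    (p.1, star q) ∈ conjSquare U ∩ sliceSquare n := ⟨⟨hp.1.1, hqU⟩, hp.2.1, hqs⟩
  rcases a with - | a <;> rcases b with - | b
  · refine (eq_of_dirDeriv_fst_eq_zero hU hconv hf (fun j p hp => ?_) hpq hp).trans (hy y)
    exact (eq_of_dirDeriv_snd_eq_zero hU hconv (hd _ 1) (fun i p hp =>
      h (Sum.inl i) (Sum.inl j) p hp) (hpq' p hp) hp).trans
      (iterate_dirDeriv_fst_eq_zero hU hf hx ⟨hp.1.1, hqU⟩ _ 1)
  · refine (eq_of_dirDeriv_fst_eq_zero hU hconv (hd _ (b + 1)) (fun j p hp => ?_) hpq hp).trans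
      (iterate_dirDeriv_snd_eq_zero hU hf hy hpq.1 _ (b + 1))
    exact (dirDeriv_iterate_comm hUU hf (b + 1) hp.1).trans
      (h (Sum.inr ⟨b, by lia⟩) (Sum.inl j) p hp)
  · exact (eq_of_dirDeriv_snd_eq_zero hU hconv (hd (e₀, 0) (a + 1)) (fun i p hp =>
      h (Sum.inl i) (Sum.inr ⟨a, by lia⟩) p hp) (hpq' _ hp) hp).trans
      (iterate_dirDeriv_fst_eq_zero hU hf hx ⟨hp.1.1, hqU⟩ _ (a + 1))
  · exact h (Sum.inr ⟨b, by lia⟩) (Sum.inr ⟨a, by lia⟩) _ hp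

end JetVanish

section PolarKernel

variable {m n k : ℕ} {H H' : Type*} [NormedAddCommGroup H] [InnerProductSpace ℂ H]
  [NormedAddCommGroup H'] [InnerProductSpace ℂ H']

/-- The polarization of the metric `x ↦ ‖S x̄‖²` of a local frame `S` of the bundle. -/
def polarKernel (S : (Fin m → ℂ) → H) : (Fin m → ℂ) × (Fin m → ℂ) → ℂ :=
  fun p => ⟪S (star p.1), S p.2⟫_ℂ

theorem polarKernel_mk_star (S : (Fin m → ℂ) → H) (x : Fin m → ℂ) :
    polarKernel S (x, star x) = ((‖S (star x)‖ ^ 2 : ℝ) : ℂ) := by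
  simp [polarKernel, inner_self_eq_norm_sq_to_K]

theorem polarKernel_smul (S : (Fin m → ℂ) → H) (χ : (Fin m → ℂ) → ℂ)
    (p : (Fin m → ℂ) × (Fin m → ℂ)) :
    polarKernel (fun y => χ y • S y) p = star (χ (star p.1)) * χ p.2 * polarKernel S p := by
  simp only [polarKernel, inner_smul_left, inner_smul_right, Complex.star_def]
  ring

theorem star_polarKernel (S : (Fin m → ℂ) → H) (x y : Fin m → ℂ) :
    star (polarKernel S (x, y)) = polarKernel S (star y, star x) := by
  simp [polarKernel]

theorem differentiableOn_innerSL_comp_star {S : (Fin m → ℂ) → H} {U : Set (Fin m → ℂ)}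
    (hU : IsOpen U) (hS : DifferentiableOn ℂ S (star ⁻¹' U)) :
    DifferentiableOn ℂ (fun x => innerSL ℂ (S (star x))) U := by
  simpa only [← preimage_comp, star_involutive.comp_self, preimage_id] using
    differentiableOn_semilinear_comp_star (hU.preimage continuous_star) hS (innerSL ℂ)

theorem differentiableOn_polarKernel {S : (Fin m → ℂ) → H} {U : Set (Fin m → ℂ)}
    (hU : IsOpen U) (hS : DifferentiableOn ℂ S (star ⁻¹' U)) :
    DifferentiableOn ℂ (polarKernel S) (conjSquare U) :=
  differentiableOn_pairing (differentiableOn_innerSL_comp_star hU hS) hS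

variable {U : Set (Fin (n + 1) → ℂ)} {S : (Fin (n + 1) → ℂ) → H} {S' : (Fin (n + 1) → ℂ) → H'}
  [CompleteSpace H] [CompleteSpace H']

theorem mixedDeriv_polarKernel (hU : IsOpen U) (hS : DifferentiableOn ℂ S (star ⁻¹' U))
    (b a : ℕ) :
    EqOn (mixedDeriv 0 b 0 a (polarKernel S))
      (fun p => ⟪(dirDeriv e₀)^[a] S (star p.1), (dirDeriv e₀)^[b] S p.2⟫_ℂ) (conjSquare U) := by
  intro p hp
  have hstar := iterate_dirDeriv_semilinear_comp_star (hU.preimage continuous_star) hS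
    (innerSL ℂ) e₀ a (x := p.1) (by simpa using hp.1)
  refine (iterate_dirDeriv_pairing hU (hU.preimage continuous_star)
    (differentiableOn_innerSL_comp_star hU hS) hS e₀ e₀ a b hp).trans ?_
  rw [star_e₀] at hstar
  exact congrArg (· ((dirDeriv e₀)^[b] S p.2)) hstar

theorem jetVanish_polarKernel_sub_iff (hU : IsOpen U) (hS : DifferentiableOn ℂ S (star ⁻¹' U))
    (hS' : DifferentiableOn ℂ S' (star ⁻¹' U)) :
    JetVanish k U (fun p => polarKernel S p - polarKernel S' p) ↔ SameJetGram k U S S' := by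
  have key (a b) {p} (hp : p ∈ conjSquare U) :
      mixedDeriv 0 b 0 a (fun p => polarKernel S p - polarKernel S' p) p = 0 ↔
        ⟪(dirDeriv e₀)^[a] S (star p.1), (dirDeriv e₀)^[b] S p.2⟫_ℂ =
          ⟪(dirDeriv e₀)^[a] S' (star p.1), (dirDeriv e₀)^[b] S' p.2⟫_ℂ := by
    rw [mixedDeriv_sub hU (differentiableOn_polarKernel hU hS)
      (differentiableOn_polarKernel hU hS') 0 b 0 a hp]
    simp only [mixedDeriv_polarKernel hU hS b a hp, mixedDeriv_polarKernel hU hS' b a hp,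
      sub_eq_zero]
  constructor
  · intro h a ha b hb y hy y' hy' hy0 hy0'
    have hp : (star y, y') ∈ conjSquare U := ⟨hy, hy'⟩
    simpa only [star_star] using (key a b hp).1 (h a ha b hb _ ⟨hp, by simp [hy0], hy0'⟩)
  · exact fun h a ha b hb p hp => (key a b hp.1).2 <|
      h a ha b hb (star p.1) (by simpa using hp.1.1) p.2 hp.1.2
        (by simpa using hp.2.1) hp.2.2

end PolarKernel

section LogRatio

variable {m : ℕ} {H H' : Type*} [NormedAddCommGroup H] [NormedAddCommGroup H']
  {S : (Fin m → ℂ) → H} {S' : (Fin m → ℂ) → H'} {χ : (Fin m → ℂ) → ℂ}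
  {x : Fin m → ℂ}

/-- The function `log (ϱ' / ϱ)` on which `𝒟_k` acts, for the metrics `ϱ x = ‖S x̄‖²` and
`ϱ' x = ‖S' x̄‖²` of two local frames. -/
def logRatio (S : (Fin m → ℂ) → H) (S' : (Fin m → ℂ) → H') (x : Fin m → ℂ) : ℂ :=
  (Real.log (‖S' (star x)‖ ^ 2 / ‖S (star x)‖ ^ 2) : ℝ)

theorem log_metric_div_eq_logRatio (s : (Fin m → ℂ) → H) (s' : (Fin m → ℂ) → H')
    (ψ : (Fin m → ℂ) → Fin m → ℂ) :
    (fun x => ((Real.log (metric s' (ψ x) / metric s (ψ x)) : ℝ) : ℂ)) =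
      logRatio (fun y => s (star (ψ (star y)))) fun y => s' (star (ψ (star y))) := by
  ext x
  simp only [logRatio, metric, star_star]

theorem logRatio_smul [NormedSpace ℂ H'] {ℓ : ℂ} (hℓ : Complex.exp ℓ = χ (star x))
    (h0 : S (star x) ≠ 0) (h0' : S' (star x) ≠ 0) :
    logRatio S (fun y => χ y • S' y) x = logRatio S S' x + (star ℓ + ℓ) := by
  have hnorm : ‖χ (star x) • S' (star x)‖ ^ 2 / ‖S (star x)‖ ^ 2 =
      Real.exp (2 * ℓ.re) * (‖S' (star x)‖ ^ 2 / ‖S (star x)‖ ^ 2) := by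
    rw [norm_smul, ← hℓ, Complex.norm_exp, two_mul, Real.exp_add]
    ring
  rw [logRatio, hnorm, Real.log_mul (Real.exp_ne_zero _) (by simp [h0, h0']), Real.log_exp,
    logRatio, add_comm (star ℓ), Complex.star_def, Complex.add_conj, add_comm, Complex.ofReal_add]

end LogRatio

section PolarLogRatio

variable {m : ℕ} {H H' : Type*} [NormedAddCommGroup H] [InnerProductSpace ℂ H]
  [NormedAddCommGroup H'] [InnerProductSpace ℂ H'] {U : Set (Fin m → ℂ)} {q : Fin m → ℂ}
  {p : (Fin m → ℂ) × (Fin m → ℂ)} {S : (Fin m → ℂ) → H} {S' : (Fin m → ℂ) → H'}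

/-- The polarization of the quotient `ϱ' / ϱ` of the metrics of two local frames. -/
def polarRatio (S : (Fin m → ℂ) → H) (S' : (Fin m → ℂ) → H')
    (p : (Fin m → ℂ) × (Fin m → ℂ)) : ℂ :=
  polarKernel S' p / polarKernel S p

/-- The polarization of `logRatio S S'`, holomorphic where `polarRatio S S'` avoids the cut of the
principal logarithm. -/
def polarLogRatio (S : (Fin m → ℂ) → H) (S' : (Fin m → ℂ) → H')
    (p : (Fin m → ℂ) × (Fin m → ℂ)) : ℂ :=
  Complex.log (polarRatio S S' p)

theorem polarRatio_mk_star (S : (Fin m → ℂ) → H) (S' : (Fin m → ℂ) → H') (x : Fin m → ℂ) :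
    polarRatio S S' (x, star x) = ((‖S' (star x)‖ ^ 2 / ‖S (star x)‖ ^ 2 : ℝ) : ℂ) := by
  rw [polarRatio, polarKernel_mk_star, polarKernel_mk_star, ← Complex.ofReal_div]

theorem logRatio_eq_antidiag (S : (Fin m → ℂ) → H) (S' : (Fin m → ℂ) → H') :
    logRatio S S' = antidiag (polarLogRatio S S') := by
  ext x
  rw [logRatio, antidiag, polarLogRatio, polarRatio_mk_star, Complex.ofReal_log (by positivity)]

theorem polarRatio_mk_star_mem_slitPlane {x : Fin m → ℂ} :
    polarRatio S S' (x, star x) ∈ Complex.slitPlane ↔ S (star x) ≠ 0 ∧ S' (star x) ≠ 0 := by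
  rw [polarRatio_mk_star, Complex.ofReal_mem_slitPlane]
  refine ⟨fun h => ?_, fun h => ?_⟩
  · refine ⟨fun h0 => ?_, fun h0 => ?_⟩ <;> simp [h0] at h
  · have := norm_pos_iff.2 h.1
    have := norm_pos_iff.2 h.2
    positivity

theorem polarKernel_ne_zero (h : polarRatio S S' p ∈ Complex.slitPlane) : polarKernel S p ≠ 0 :=
  (div_ne_zero_iff.1 (Complex.slitPlane_ne_zero h)).2

theorem exp_polarLogRatio_mul (h : polarRatio S S' p ∈ Complex.slitPlane) :
    Complex.exp (polarLogRatio S S' p) * polarKernel S p = polarKernel S' p := by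
  rw [polarLogRatio, Complex.exp_log (Complex.slitPlane_ne_zero h), polarRatio,
    div_mul_cancel₀ _ (polarKernel_ne_zero h)]

theorem star_polarLogRatio {x y : Fin m → ℂ} (h : polarRatio S S' (x, y) ∈ Complex.slitPlane) :
    star (polarLogRatio S S' (x, y)) = polarLogRatio S S' (star y, star x) := by
  rw [polarLogRatio, Complex.star_def,
    ← Complex.log_conj _ (Complex.mem_slitPlane_iff_arg.1 h).1, ← Complex.star_def, polarRatio,
    star_div₀, star_polarKernel, star_polarKernel, polarLogRatio, polarRatio]

theorem differentiableOn_polarRatio (hU : IsOpen U) (hS : DifferentiableOn ℂ S (star ⁻¹' U))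
    (hS' : DifferentiableOn ℂ S' (star ⁻¹' U)) (h0 : ∀ p ∈ conjSquare U, polarKernel S p ≠ 0) :
    DifferentiableOn ℂ (polarRatio S S') (conjSquare U) :=
  ((differentiableOn_polarKernel hU hS').fun_mul
    ((differentiableOn_polarKernel hU hS).fun_inv h0)).congr fun _ _ => div_eq_mul_inv _ _

theorem differentiableOn_polarLogRatio (hU : IsOpen U) (hS : DifferentiableOn ℂ S (star ⁻¹' U))
    (hS' : DifferentiableOn ℂ S' (star ⁻¹' U))
    (hslit : MapsTo (polarRatio S S') (conjSquare U) Complex.slitPlane) :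
    DifferentiableOn ℂ (polarLogRatio S S') (conjSquare U) :=
  (differentiableOn_polarRatio hU hS hS' fun _ hp => polarKernel_ne_zero (hslit hp)).clog hslit

theorem exists_convex_conjSquare_subset (hU : U ∈ 𝓝 q)
    {W : Set ((Fin m → ℂ) × (Fin m → ℂ))} (hW : W ∈ 𝓝 (q, star q)) :
    ∃ V ⊆ U, IsOpen V ∧ Convex ℝ V ∧ q ∈ V ∧ conjSquare V ⊆ W := by
  obtain ⟨r, hr, hrU⟩ := Metric.mem_nhds_iff.1 hU
  obtain ⟨δ, hδ, hδW⟩ := Metric.mem_nhds_iff.1 hW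
  refine ⟨ball q (min r δ), (ball_subset_ball (min_le_left _ _)).trans hrU, isOpen_ball,
    convex_ball _ _, mem_ball_self (lt_min hr hδ), fun p hp => hδW ?_⟩
  rw [← ball_prod_same]
  have hp2 : dist p.2 (star q) < min r δ := by
    rw [← dist_star_star, star_star]
    exact hp.2
  exact ⟨(mem_ball.1 hp.1).trans_le (min_le_right _ _), hp2.trans_le (min_le_right _ _)⟩

theorem exists_convex_mapsTo_polarRatio_slitPlane (hU : IsOpen U) (hq : q ∈ U)
    (hS : DifferentiableOn ℂ S (star ⁻¹' U)) (hS' : DifferentiableOn ℂ S' (star ⁻¹' U))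
    (h0 : S (star q) ≠ 0) (h0' : S' (star q) ≠ 0) :
    ∃ V ⊆ U, IsOpen V ∧ Convex ℝ V ∧ q ∈ V ∧
      MapsTo (polarRatio S S') (conjSquare V) Complex.slitPlane := by
  have hnhds := (isOpen_conjSquare hU).mem_nhds (mk_star_mem_conjSquare hq)
  have hslit := polarRatio_mk_star_mem_slitPlane.2 ⟨h0, h0'⟩
  have hcont : ContinuousAt (polarRatio S S') (q, star q) :=
    ((differentiableOn_polarKernel hU hS').continuousOn.continuousAt hnhds).div
      ((differentiableOn_polarKernel hU hS).continuousOn.continuousAt hnhds)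
      (polarKernel_ne_zero hslit)
  exact exists_convex_conjSquare_subset (hU.mem_nhds hq)
    (hcont (Complex.isOpen_slitPlane.mem_nhds hslit))

theorem exists_exp_eq {E : Type*} [NormedAddCommGroup E] [NormedSpace ℂ E] {f : E → ℂ}
    {W : Set E} (hW : IsOpen W) (hf : DifferentiableOn ℂ f W) {z : E} (hz : z ∈ W)
    (hfz : f z ≠ 0) :
    ∃ V ⊆ W, IsOpen V ∧ z ∈ V ∧ ∃ g : E → ℂ,
      DifferentiableOn ℂ g V ∧ ∀ w ∈ V, Complex.exp (g w) = f w := by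
  have hdiv : DifferentiableOn ℂ (fun w => f w * (f z)⁻¹) W := hf.mul_const _
  refine ⟨W ∩ (fun w => f w * (f z)⁻¹) ⁻¹' Complex.slitPlane, inter_subset_left,
    hdiv.continuousOn.isOpen_inter_preimage hW Complex.isOpen_slitPlane,
    ⟨hz, by simp [mul_inv_cancel₀ hfz]⟩,
    fun w => Complex.log (f w * (f z)⁻¹) + Complex.log (f z),
    ((hdiv.mono inter_subset_left).clog fun _ hw => hw.2).add_const _, fun w hw => ?_⟩
  rw [Complex.exp_add, Complex.exp_log (Complex.slitPlane_ne_zero hw.2), Complex.exp_log hfz,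
    inv_mul_cancel_right₀ hfz]

end PolarLogRatio

section Diastasis

variable {n k : ℕ} {U : Set (Fin (n + 1) → ℂ)} {q : Fin (n + 1) → ℂ}
  {Φ : (Fin (n + 1) → ℂ) × (Fin (n + 1) → ℂ) → ℂ}

/-- The polarization of Calabi's diastasis, based at `q`, of the potential with polarization `Φ`:
the modification of `Φ` by a function of `x` and a function of `y` that vanishes for `x = q` and
for `y = q̄`. -/
def diastasis (q : Fin (n + 1) → ℂ) (Φ : (Fin (n + 1) → ℂ) × (Fin (n + 1) → ℂ) → ℂ)
    (p : (Fin (n + 1) → ℂ) × (Fin (n + 1) → ℂ)) : ℂ :=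
  Φ p + ((Φ (q, star q) - Φ (p.1, star q)) + -Φ (q, p.2))

theorem differentiableOn_comp_mk_star (hΦ : DifferentiableOn ℂ Φ (conjSquare U)) (hq : q ∈ U) :
    DifferentiableOn ℂ (fun x => Φ (x, star q)) U :=
  hΦ.comp (f := fun x => (x, star q)) (by fun_prop) fun _ hx =>
    ⟨hx, (mk_star_mem_conjSquare hq).2⟩

theorem differentiableOn_comp_mk (hΦ : DifferentiableOn ℂ Φ (conjSquare U)) (hq : q ∈ U) :
    DifferentiableOn ℂ (fun y => Φ (q, y)) (star ⁻¹' U) :=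
  hΦ.comp (f := fun y => (q, y)) (by fun_prop) fun _ hy => ⟨hq, hy⟩

theorem differentiableOn_diastasis (hΦ : DifferentiableOn ℂ Φ (conjSquare U)) (hq : q ∈ U) :
    DifferentiableOn ℂ (diastasis q Φ) (conjSquare U) :=
  hΦ.fun_add
    ((((differentiableOn_comp_mk_star hΦ hq).comp differentiableOn_fst fun _ hp =>
      hp.1).const_sub _).fun_add
      ((differentiableOn_comp_mk hΦ hq).comp differentiableOn_snd fun _ hp => hp.2).fun_neg)

theorem polarEntry_diastasis (hU : IsOpen U) (hΦ : DifferentiableOn ℂ Φ (conjSquare U))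
    (hq : q ∈ U) (i j : Fin n ⊕ Fin (k - 1)) :
    EqOn (polarEntry i j (diastasis q Φ)) (polarEntry i j Φ) (conjSquare U) :=
  polarEntry_add_separated hU hΦ ((differentiableOn_comp_mk_star hΦ hq).const_sub _)
    (differentiableOn_comp_mk hΦ hq).fun_neg i j

theorem jetVanish_diastasis (hU : IsOpen U) (hconv : Convex ℝ U)
    (hΦ : DifferentiableOn ℂ Φ (conjSquare U)) (hq : q ∈ U) (hq0 : q 0 = 0)
    (h : ∀ x ∈ U, x 0 = 0 → diffArray k (antidiag Φ) x = 0) : JetVanish k U (diastasis q Φ) := by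
  refine jetVanish_of_polarEntry_eq_zero hU hconv (differentiableOn_diastasis hΦ hq) hq hq0
    (fun x => by simp only [diastasis]; ring) (fun y => by simp only [diastasis]; ring)
    fun i j p hp => ?_
  refine (polarEntry_diastasis hU hΦ hq i j hp.1).trans ?_
  refine eq_zero_of_eq_zero_mk_star hU hconv (slice n) (G := polarEntry i j Φ)
    (differentiableOn_mixedDeriv hU hΦ _ _ _ _) (fun x hx => ?_) ⟨hp.1.1, hp.2.1⟩
    ⟨hp.1.2, by simpa using hp.2.2⟩
  rw [← diffArray_apply_eq_polarEntry hU hΦ (eqOn_refl _ _) hx.1, h x hx.1 hx.2,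
    Matrix.zero_apply]

end Diastasis

section FrameChange

variable {n k : ℕ} {H H' : Type*} [NormedAddCommGroup H] [InnerProductSpace ℂ H]
  [NormedAddCommGroup H'] [InnerProductSpace ℂ H'] {U : Set (Fin (n + 1) → ℂ)}
  {q : Fin (n + 1) → ℂ} {S : (Fin (n + 1) → ℂ) → H} {S' : (Fin (n + 1) → ℂ) → H'}
  {χ : (Fin (n + 1) → ℂ) → ℂ}

/- `log |χ|²` is locally the sum of a holomorphic and an antiholomorphic function, and each entry of
`𝒟_k` differentiates in both `z` and `z̄`. -/
theorem diffArray_logRatio_smul (hU : IsOpen U) (hq : q ∈ U)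
    (hS : DifferentiableOn ℂ S (star ⁻¹' U)) (hS' : DifferentiableOn ℂ S' (star ⁻¹' U))
    (hχ : DifferentiableOn ℂ χ (star ⁻¹' U)) (h0 : S (star q) ≠ 0) (h0' : S' (star q) ≠ 0)
    (hχ0 : χ (star q) ≠ 0) :
    diffArray k (logRatio S fun y => χ y • S' y) q = diffArray k (logRatio S S') q := by
  obtain ⟨V, hVU, hV, -, hqV, hslit⟩ :=
    exists_convex_mapsTo_polarRatio_slitPlane hU hq hS hS' h0 h0'
  obtain ⟨W, hWV, hW, hqW, ℓ, hℓ, hexp⟩ := exists_exp_eq (hV.preimage continuous_star)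
    (hχ.mono (preimage_mono hVU)) (mk_star_mem_conjSquare hqV).2 hχ0
  have hWW : star ⁻¹' (star ⁻¹' W) = W := by
    rw [← preimage_comp, star_involutive.comp_self, preimage_id]
  have hW' : IsOpen (star ⁻¹' W) := hW.preimage continuous_star
  have hsub : star ⁻¹' W ⊆ V := fun x hx => by simpa using hWV hx
  have hL : DifferentiableOn ℂ (polarLogRatio S S') (conjSquare (star ⁻¹' W)) :=
    (differentiableOn_polarLogRatio hV (hS.mono (preimage_mono hVU))
      (hS'.mono (preimage_mono hVU)) hslit).mono (prod_mono hsub (preimage_mono hsub))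
  have hA : DifferentiableOn ℂ (fun x => star (ℓ (star x))) (star ⁻¹' W) :=
    differentiableOn_semilinear_comp_star hW hℓ (starL ℂ : ℂ ≃L⋆[ℂ] ℂ).toContinuousLinearMap
  have hB : DifferentiableOn ℂ ℓ (star ⁻¹' (star ⁻¹' W)) := hWW.symm ▸ hℓ
  have hadd : DifferentiableOn ℂ
      (fun p => polarLogRatio S S' p + (star (ℓ (star p.1)) + ℓ p.2)) (conjSquare (star ⁻¹' W)) :=
    hL.fun_add ((hA.comp differentiableOn_fst fun _ hp => hp.1).fun_add
      (hB.comp differentiableOn_snd fun _ hp => hp.2))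
  have hlog : EqOn (logRatio S fun y => χ y • S' y)
      (antidiag fun p => polarLogRatio S S' p + (star (ℓ (star p.1)) + ℓ p.2)) (star ⁻¹' W) :=
    fun x hx => by
      have hne := polarRatio_mk_star_mem_slitPlane.1 (hslit (mk_star_mem_conjSquare (hsub hx)))
      rw [logRatio_smul (hexp _ hx) hne.1 hne.2, logRatio_eq_antidiag]
      rfl
  ext i j
  rw [diffArray_apply_eq_polarEntry hW' hadd hlog hqW,
    polarEntry_add_separated hW' hL hA hB i j (mk_star_mem_conjSquare hqW), logRatio_eq_antidiag,
    diffArray_apply_eq_polarEntry hW' hL (eqOn_refl _ _) hqW]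

theorem jetVanish_polarLogRatio (hU : IsOpen U) (hS : DifferentiableOn ℂ S (star ⁻¹' U))
    (hS' : DifferentiableOn ℂ S' (star ⁻¹' U))
    (hslit : MapsTo (polarRatio S S') (conjSquare U) Complex.slitPlane)
    (h : JetVanish k U fun p => polarKernel S p - polarKernel S' p) :
    JetVanish k U (polarLogRatio S S') := by
  have hκ := differentiableOn_polarKernel hU hS
  have h0 (p) (hp : p ∈ conjSquare U) : polarKernel S p ≠ 0 := polarKernel_ne_zero (hslit hp)
  have hratio : JetVanish k U fun p => polarRatio S S' p - 1 :=
    (h.smul hU (hκ.fun_sub (differentiableOn_polarKernel hU hS')) (hκ.fun_inv h0).fun_neg).congr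
      hU fun p hp => by
        have := h0 p hp
        simp only [polarRatio, smul_eq_mul]
        field_simp
        ring
  have hlog : DifferentiableOn ℂ (fun z : ℂ => Complex.log (z + 1))
      ((· + 1) ⁻¹' Complex.slitPlane) :=
    DifferentiableOn.clog (by fun_prop) fun _ hz => hz
  have hO : ((· + 1) ⁻¹' Complex.slitPlane : Set ℂ) ∈ 𝓝 0 :=
    (Complex.isOpen_slitPlane.preimage (by fun_prop)).mem_nhds (by simp)
  refine (hratio.comp hU ((differentiableOn_polarRatio hU hS hS' h0).sub_const 1) hO hlog
    (by simp) fun p hp => ?_).congr hU fun p _ => ?_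
  · simpa using hslit hp
  · simp [polarLogRatio]

theorem SameJetGram.ne_zero_of_ne_zero (h : SameJetGram k U S S') (hk : 1 ≤ k) (hq : q ∈ U)
    (hq0 : q 0 = 0) (h0 : S (star q) ≠ 0) : S' (star q) ≠ 0 := by
  have hqU : star (star q) ∈ U := by rwa [star_star]
  have hq0' : star q 0 = 0 := by simp [hq0]
  have hinner : ⟪S (star q), S (star q)⟫_ℂ = ⟪S' (star q), S' (star q)⟫_ℂ :=
    h 0 hk 0 hk _ hqU _ hqU hq0' hq0'
  rw [← inner_self_ne_zero (𝕜 := ℂ)] at h0 ⊢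
  rwa [← hinner]

theorem SameJetGram.diffArray_logRatio_eq_zero [CompleteSpace H] [CompleteSpace H'] (hk : 1 ≤ k)
    (hU : IsOpen U) (hq : q ∈ U) (hq0 : q 0 = 0) (hS : DifferentiableOn ℂ S (star ⁻¹' U))
    (hS' : DifferentiableOn ℂ S' (star ⁻¹' U)) (h0 : S (star q) ≠ 0)
    (h : SameJetGram k U S S') : diffArray k (logRatio S S') q = 0 := by
  obtain ⟨V, hVU, hV, -, hqV, hslit⟩ := exists_convex_mapsTo_polarRatio_slitPlane hU hq hS hS' h0
    (h.ne_zero_of_ne_zero hk hq hq0 h0)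
  have hSV := hS.mono (preimage_mono hVU)
  have hSV' := hS'.mono (preimage_mono hVU)
  have hL := differentiableOn_polarLogRatio hV hSV hSV' hslit
  have hJ : JetVanish k V (polarLogRatio S S') :=
    jetVanish_polarLogRatio hV hSV hSV' hslit
      (((jetVanish_polarKernel_sub_iff hU hS hS').2 h).mono hVU)
  ext i j
  rw [logRatio_eq_antidiag, diffArray_apply_eq_polarEntry hV hL (eqOn_refl _ _) hqV,
    Matrix.zero_apply]
  exact hJ.polarEntry_eq_zero hV hk hL i j _
    ⟨mk_star_mem_conjSquare hqV, by simpa using hq0⟩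

/-- The factor by which a frame `S` has to be multiplied at `y` so that its metric and that of `S'`
have the same polarization for `x = q` and for `y = q̄`. -/
def normalizer (q : Fin (n + 1) → ℂ) (S : (Fin (n + 1) → ℂ) → H) (S' : (Fin (n + 1) → ℂ) → H')
    (y : Fin (n + 1) → ℂ) : ℂ :=
  Complex.exp (polarLogRatio S S' (q, y) - polarLogRatio S S' (q, star q) / 2)

theorem polarKernel_normalizer_smul_mul_exp_diastasis (hq : q ∈ U)
    (hslit : MapsTo (polarRatio S S') (conjSquare U) Complex.slitPlane)
    {p : (Fin (n + 1) → ℂ) × (Fin (n + 1) → ℂ)} (hp : p ∈ conjSquare U) :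
    polarKernel (fun y => normalizer q S S' y • S y) p *
      Complex.exp (diastasis q (polarLogRatio S S') p) = polarKernel S' p := by
  set L := polarLogRatio S S' with hL
  have hconj {x} (hx : x ∈ U) : star (L (q, star x)) = L (x, star q) := by
    rw [hL, star_polarLogRatio (hslit ⟨hq, (mk_star_mem_conjSquare hx).2⟩), star_star]
  have hstar : star (normalizer q S S' (star p.1)) =
      Complex.exp (L (p.1, star q) - L (q, star q) / 2) := by
    rw [normalizer, Complex.star_def, ← Complex.exp_conj, map_sub, map_div₀, ← Complex.star_def,
      hconj hp.1, hconj hq]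
    simp
  rw [← exp_polarLogRatio_mul (hslit hp), polarKernel_smul, hstar, normalizer, mul_right_comm,
    ← Complex.exp_add, ← Complex.exp_add]
  congr 2
  rw [diastasis]
  ring

theorem exists_sameJetGram_smul_of_diffArray_logRatio_eq_zero [CompleteSpace H]
    [CompleteSpace H'] (hU : IsOpen U) (hq : q ∈ U) (hq0 : q 0 = 0)
    (hS : DifferentiableOn ℂ S (star ⁻¹' U)) (hS' : DifferentiableOn ℂ S' (star ⁻¹' U))
    (h0 : S (star q) ≠ 0) (h0' : S' (star q) ≠ 0)
    (h : ∀ x ∈ U, x 0 = 0 → diffArray k (logRatio S S') x = 0) :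
    ∃ V ⊆ U, IsOpen V ∧ q ∈ V ∧ ∃ χ : (Fin (n + 1) → ℂ) → ℂ,
      DifferentiableOn ℂ χ (star ⁻¹' V) ∧ (∀ y, χ y ≠ 0) ∧
        SameJetGram k V (fun y => χ y • S y) S' := by
  obtain ⟨V, hVU, hV, hconv, hqV, hslit⟩ :=
    exists_convex_mapsTo_polarRatio_slitPlane hU hq hS hS' h0 h0'
  have hSV := hS.mono (preimage_mono hVU)
  have hSV' := hS'.mono (preimage_mono hVU)
  have hL := differentiableOn_polarLogRatio hV hSV hSV' hslit
  have hD := differentiableOn_diastasis hL hqV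
  have hχ : DifferentiableOn ℂ (normalizer q S S') (star ⁻¹' V) :=
    ((differentiableOn_comp_mk hL hqV).sub_const _).cexp
  have hχS := hχ.fun_smul hSV
  refine ⟨V, hVU, hV, hqV, normalizer q S S', hχ, fun _ => Complex.exp_ne_zero _,
    (jetVanish_polarKernel_sub_iff hV hχS hSV').1 ?_⟩
  have hDJ : JetVanish k V (diastasis q (polarLogRatio S S')) :=
    jetVanish_diastasis hV hconv hL hqV hq0 fun x hx hx0 => by
      rw [← logRatio_eq_antidiag]
      exact h x (hVU hx) hx0
  have hEJ : JetVanish k V fun p => 1 - Complex.exp (diastasis q (polarLogRatio S S') p) :=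
    hDJ.comp hV hD univ_mem (φ := fun z => 1 - Complex.exp z) (by fun_prop) (by simp)
      (mapsTo_univ _ _)
  refine (hEJ.smul hV (hD.cexp.const_sub 1) (differentiableOn_polarKernel hV hχS)).congr hV
    fun p hp => ?_
  simp only [smul_eq_mul]
  rw [mul_one_sub, polarKernel_normalizer_smul_mul_exp_diastasis hqV hslit hp]

end FrameChange

section Equivalence

variable {n k : ℕ} {Ω Z : Set (Fin (n + 1) → ℂ)}
  {charts : Set (OpenPartialHomeomorph (Fin (n + 1) → ℂ) (Fin (n + 1) → ℂ))}
  {H H' : Type*} [NormedAddCommGroup H] [InnerProductSpace ℂ H] [CompleteSpace H]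
  [NormedAddCommGroup H'] [InnerProductSpace ℂ H'] [CompleteSpace H']
  {M : QuasiFreeModule Ω H} {M' : QuasiFreeModule Ω H'}
  {s : (Fin (n + 1) → ℂ) → H} {s' : (Fin (n + 1) → ℂ) → H'}

theorem equivalentToOrder_of_quotientsIsomorphic (hiso : QuotientsIsomorphic M M' Z k)
    (hk : 1 ≤ k) (hs : M.IsFrame s) (hs' : M'.IsFrame s') (hΩ : IsOpen Ω) (hZ : Z ⊆ Ω)
    (hcharts : ∀ e ∈ charts, IsAdaptedChart Ω Z e) :
    EquivalentToOrder Z charts k (metric s) (metric s') := by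
  rintro e hec z ⟨hze, hzZ⟩
  have he := hcharts e hec
  have hq := e.map_source hze
  have hq0 := (he.mem_iff z hze).1 hzZ
  have hS := hs.isLocalFrame e.open_target he.differentiableOn_symm fun _ => he.symm_mem
  have hS' := hs'.isLocalFrame e.open_target he.differentiableOn_symm fun _ => he.symm_mem
  obtain ⟨χ, hχ, hgram⟩ := exists_sameJetGram_smul hiso hs' hΩ hZ he subset_rfl hS hS'
  have hS0 := hS.ne_zero (star (e z)) (by rwa [star_star])
  have hS0' := hS'.ne_zero (star (e z)) (by rwa [star_star])
  have hχ0 := (smul_ne_zero_iff.1 (hgram.ne_zero_of_ne_zero hk hq hq0 hS0)).1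
  rw [log_metric_div_eq_logRatio, ← diffArray_logRatio_smul e.open_target hq hS.differentiableOn
    hS'.differentiableOn hχ hS0 hS0' hχ0]
  exact hgram.diffArray_logRatio_eq_zero hk e.open_target hq hq0 hS.differentiableOn
    (hχ.fun_smul hS'.differentiableOn) hS0

theorem quotientsIsomorphic_of_equivalentToOrder
    (h : EquivalentToOrder Z charts k (metric s) (metric s')) (hs : M.IsFrame s)
    (hs' : M'.IsFrame s') (hΩ : IsOpen Ω) (hZ : IsConnected Z)
    (hcharts : ∀ e ∈ charts, IsAdaptedChart Ω Z e)
    (hcover : ∀ p ∈ Z, ∃ e ∈ charts, p ∈ e.source) : QuotientsIsomorphic M M' Z k := by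
  obtain ⟨z, hz⟩ := hZ.nonempty
  obtain ⟨e, hec, hze⟩ := hcover z hz
  have he := hcharts e hec
  have hq := e.map_source hze
  have hq0 := (he.mem_iff z hze).1 hz
  have hS := hs.isLocalFrame e.open_target he.differentiableOn_symm fun _ => he.symm_mem
  have hS' := hs'.isLocalFrame e.open_target he.differentiableOn_symm fun _ => he.symm_mem
  obtain ⟨V, hVe, hV, hqV, χ, hχ, hχ0, hgram⟩ :=
    exists_sameJetGram_smul_of_diffArray_logRatio_eq_zero (k := k) e.open_target hq hq0
      hS.differentiableOn hS'.differentiableOn (hS.ne_zero _ (by rwa [star_star]))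
      (hS'.ne_zero _ (by rwa [star_star])) fun x hx hx0 => by
        have hD := h e hec (e.symm x) ⟨e.map_target hx, (he.symm_mem_iff hx).2 hx0⟩
        rwa [e.right_inv hx, log_metric_div_eq_logRatio] at hD
  exact hgram.quotientsIsomorphic hs hs' hΩ hcharts hcover hZ.isPreconnected he hVe hqV hq0
    ((hS.mono hV hVe).smul hχ fun y _ => hχ0 y) (hS'.mono hV hVe)

end Equivalence

end JetQuotient

end

theorem theorem1_general {n k : ℕ} (hk : 1 ≤ k) {Ω Z : Set (Fin (n + 1) → ℂ)}
    (hΩ_open : IsOpen Ω) (hZ_conn : IsConnected Z)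
    (charts : Set (OpenPartialHomeomorph (Fin (n + 1) → ℂ) (Fin (n + 1) → ℂ)))
    (hcharts : ∀ e ∈ charts, JetQuotient.IsAdaptedChart Ω Z e)
    (hcover : ∀ p ∈ Z, ∃ e ∈ charts, p ∈ e.source)
    {H H' : Type*} [NormedAddCommGroup H] [InnerProductSpace ℂ H] [CompleteSpace H]
    [NormedAddCommGroup H'] [InnerProductSpace ℂ H'] [CompleteSpace H']
    (M : JetQuotient.QuasiFreeModule Ω H) (M' : JetQuotient.QuasiFreeModule Ω H')
    (s : (Fin (n + 1) → ℂ) → H) (hs : M.IsFrame s)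
    (s' : (Fin (n + 1) → ℂ) → H') (hs' : M'.IsFrame s') :
    JetQuotient.QuotientsIsomorphic M M' Z k ↔
      JetQuotient.EquivalentToOrder Z charts k (JetQuotient.metric s) (JetQuotient.metric s') := by
  have hZ : Z ⊆ Ω := fun z hz => by
    obtain ⟨e, he, hze⟩ := hcover z hz
    exact (hcharts e he).source_subset hze
  exact ⟨fun hiso => JetQuotient.equivalentToOrder_of_quotientsIsomorphic hiso hk hs hs' hΩ_open
      hZ hcharts,
    fun h => JetQuotient.quotientsIsomorphic_of_equivalentToOrder h hs hs' hΩ_open hZ_conn hcharts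
      hcover⟩

theorem theorem1 {n k : ℕ} (hk : 1 ≤ k) {Ω Z : Set (Fin (n + 1) → ℂ)}
    (hΩ_open : IsOpen Ω) (hΩ_conn : IsConnected Ω) (hΩ_bdd : Bornology.IsBounded Ω)
    (hZ : JetQuotient.IsHypersurface Ω Z) (hZ_conn : IsConnected Z)
    (charts : Set (OpenPartialHomeomorph (Fin (n + 1) → ℂ) (Fin (n + 1) → ℂ)))
    (hcharts : ∀ e ∈ charts, JetQuotient.IsAdaptedChart Ω Z e)
    (hcover : ∀ p ∈ Z, ∃ e ∈ charts, p ∈ e.source)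
    {H H' : Type*} [NormedAddCommGroup H] [InnerProductSpace ℂ H] [CompleteSpace H]
    [NormedAddCommGroup H'] [InnerProductSpace ℂ H'] [CompleteSpace H']
    (M : JetQuotient.QuasiFreeModule Ω H) (M' : JetQuotient.QuasiFreeModule Ω H')
    (s : (Fin (n + 1) → ℂ) → H) (hs : M.IsFrame s)
    (s' : (Fin (n + 1) → ℂ) → H') (hs' : M'.IsFrame s') :
    JetQuotient.QuotientsIsomorphic M M' Z k ↔
      JetQuotient.EquivalentToOrder Z charts k (JetQuotient.metric s) (JetQuotient.metric s') :=
  theorem1_general hk hΩ_open hZ_conn charts hcharts hcover M M' s hs s' hs'
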